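/- Let $n\ge 1$ and let $Y_n=\{1,\dots,n\}\times\mathbb{N}$, where $\mathbb N=\{1,2,\dots\}$. Let $\mathcal{M}_n$ be the monoid of all injective maps $\alpha:Y_n\to Y_n$, acting on the right (so $\alpha\beta$ means $\alpha$ followed by $\beta$), for which there are $(m_1,\dots,m_n)\in\mathbb{Z}^n$ and a finite set $K\subset Y_n$ such that $(k,p)\alpha=(k,p+m_k)$ for all $(k,p)\in Y_n\setminus K$. For $1\le i\le n$ let $t_i\in\mathcal{M}_n$ be given by $(i,p)t_i=(i,p+1)$ and $(j,p)t_i=(j,p)$ for $j\ne i$. Let $\mathcal{C}_n$ be the graph with vertex set $\mathcal{M}_n$ and one edge joining $\alpha$ to $t_i\alpha$ for each $\alpha\in\mathcal{M}_n$ and each $i$. Let $X_n$ be the space with $X_n^{(1)}=\mathcal{C}_n$ in which, for each $k\ge 2$, $X_n^{(k)}$ is obtained from $X_n^{(k-1)}$ by attaching one $k$-cube along every copy of the boundary of a $k$-cube in $X_n^{(k-1)}$, with the weak topology. A cubical complex is a (Hausdorff) CW complex whose cells are cubes such that each attaching map $\varphi:\partial I^k\to X^{(k-1)}$ is a homeomorphism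 onto its image and maps each facet of $I^k$ isomorphically (by an isometry of cubes) onto a $(k-1)$-cube. The link of a vertex $v$ is the union, over all cubes $\sigma$ containing $v$, of the simplices spanned by the edges of $\sigma$ at $v$. It is a flag complex if it is a simplicial complex and every nonempty collection of pairwise adjacent vertices spans a simplex. A cubing is a simply connected cubical complex in which the link of every vertex is a flag complex (that is, which is non-positively curved in the sense of Gromov's link condition). **Theorem.** For every $n\ge 1$, $X_n$ with its cubes is a cubing: it is a cubical complex, it is simply connected, and the link of each of its vertices is a flag complex. -/

import Mathlib

open Set Metric Topology

/-! ### The monoid of eventually translating injections of `n` rays -/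

/-- `n` disjoint copies of the positive integers. The element `(k, p)`, with `p : ℕ` counted from
`0`, is the point at distance `p + 1` from the origin on the `k`-th ray. -/
abbrev Rays (n : ℕ) : Type := Fin n × ℕ

/-- Outside a finite set, `f` translates the `k`-th ray by `m k`. -/
def IsEventualTranslation {n : ℕ} (f : Rays n → Rays n) : Prop :=
  ∃ (m : Fin n → ℤ) (K : Finset (Rays n)), ∀ (k : Fin n) (p : ℕ), (k, p) ∉ K →
    (f (k, p)).1 = k ∧ ((f (k, p)).2 : ℤ) = p + m k

/-- The set `𝓜ₙ` of injective eventual translations of the `n` rays. -/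
def HoughtonMonoid (n : ℕ) : Type :=
  {f : Rays n → Rays n // Function.Injective f ∧ IsEventualTranslation f}

namespace HoughtonMonoid

theorem isEventualTranslation_comp {n : ℕ} {f g : Rays n → Rays n} (hf : Function.Injective f)
    (hft : IsEventualTranslation f) (hgt : IsEventualTranslation g) :
    IsEventualTranslation (g ∘ f) := by
  classical
  obtain ⟨m, K, hK⟩ := hft
  obtain ⟨m', K', hK'⟩ := hgt
  refine ⟨fun k => m k + m' k, K ∪ K'.preimage f hf.injOn, fun k p hkp => ?_⟩
  simp only [Finset.mem_union, Finset.mem_preimage, not_or] at hkp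
  obtain ⟨h1, h2⟩ := hK k p hkp.1
  have h3 : (k, (f (k, p)).2) = f (k, p) := Prod.ext h1.symm rfl
  obtain ⟨h4, h5⟩ := hK' k (f (k, p)).2 (by rw [h3]; exact hkp.2)
  rw [h3] at h4 h5
  refine ⟨h4, ?_⟩
  simp only [Function.comp_apply]
  rw [h5, h2]
  ring

/-- Maps act on the right: `α * β` is `α` followed by `β`. -/
instance (n : ℕ) : Monoid (HoughtonMonoid n) where
  mul α β := ⟨β.1 ∘ α.1, β.2.1.comp α.2.1, isEventualTranslation_comp α.2.1 α.2.2 β.2.2⟩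
  one := ⟨id, Function.injective_id, 0, ∅, fun k p _ => ⟨rfl, by simp⟩⟩
  mul_assoc _ _ _ := rfl
  one_mul _ := rfl
  mul_one _ := rfl

/-- The generator `tᵢ`: translation by `1` on the `i`-th ray, identity on the other rays. -/
def t {n : ℕ} (i : Fin n) : HoughtonMonoid n :=
  ⟨fun y => if y.1 = i then (y.1, y.2 + 1) else y, by
    rintro ⟨a, p⟩ ⟨b, q⟩ h
    dsimp only at h
    split_ifs at h <;> simp_all [Prod.ext_iff], by
    refine ⟨fun k => if k = i then 1 else 0, ∅, fun k p _ => ?_⟩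
    by_cases h : k = i <;> simp [h]⟩

theorem mul_apply {n : ℕ} (α β : HoughtonMonoid n) (y : Rays n) : (α * β).1 y = β.1 (α.1 y) := rfl

/-- The Cayley graph has no loops. -/
theorem t_mul_ne {n : ℕ} (i : Fin n) (α : HoughtonMonoid n) : t i * α ≠ α := by
  intro h
  have h1 : (t i * α).1 (i, 0) = α.1 (i, 0) := by rw [h]
  rw [mul_apply] at h1
  simpa [t] using α.2.1 h1

/-- The Cayley graph has no multiple edges: the end points of an edge determine its label. -/
theorem t_mul_injective {n : ℕ} {i j : Fin n} {α : HoughtonMonoid n} (h : t i * α = t j * α) :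
    i = j := by
  have h1 : (t i * α).1 (i, 0) = (t j * α).1 (i, 0) := by rw [h]
  rw [mul_apply, mul_apply] at h1
  by_contra hij
  simpa [t, hij] using α.2.1 h1

end HoughtonMonoid

/-- The Cayley graph `𝓒ₙ`: the vertices are the elements of `𝓜ₙ`, with an edge from `α` to `tᵢ α`
for all `α` and `i`. The orientation is forgotten; since there are no loops and no multiple edges
(`HoughtonMonoid.t_mul_ne`, `HoughtonMonoid.t_mul_injective`) this is a simple graph. -/
def cayleyGraph (n : ℕ) : SimpleGraph (HoughtonMonoid n) :=
  SimpleGraph.fromRel fun α β => ∃ i : Fin n, β = HoughtonMonoid.t i * α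

/-! ### Filling all cubes in a graph -/

/-- The 1-skeleton of the `k`-cube `[-1, 1]ᵏ`: its vertices are the sign vectors, two of them
being adjacent if they differ in exactly one coordinate. -/
def cubeGraph (k : ℕ) : SimpleGraph (Fin k → ℤˣ) where
  Adj u v := hammingDist u v = 1
  symm := ⟨fun u v h => by rwa [hammingDist_comm]⟩
  loopless := ⟨fun u h => by simp at h⟩

/-- The solid cube `[-1, 1]ᵏ`, as the closed unit ball of `ℝᵏ` for the sup norm. -/
abbrev SolidCube (k : ℕ) : Type := closedBall (0 : Fin k → ℝ) 1

/-- A parametrized `k`-cube in a graph: an injective graph homomorphism from the 1-skeleton of the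
`k`-cube. -/
abbrev ParamCube {V : Type} (G : SimpleGraph V) : Type :=
  Σ k : ℕ, SimpleGraph.Copy (cubeGraph k) G

/-- The affine map `[-1, 1]ʲ → [-1, 1]ᵏ` onto a face: the `a`-th coordinate, up to the sign `s a`,
becomes the `ι a`-th coordinate, and the other coordinates are constants given by `c`.
It is used for points (`R = ℝ`) and for vertices (`R = ℤˣ`). -/
noncomputable def faceMap {R : Type} [Mul R] {j k : ℕ} (ι : Fin j ↪ Fin k) (s : Fin j → R)
    (c : Fin k → R) (x : Fin j → R) : Fin k → R :=
  Function.extend ι (fun a => s a * x a) c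

/-- The point `p` of a parametrized cube is glued to the point `q` of another one if the first cube
is a face of the second one (in any parametrization; possibly the whole cube) and the inclusion
of this face maps `p` to `q`. -/
def IsGlued {V : Type} (G : SimpleGraph V) (p q : Σ f : ParamCube G, SolidCube f.1) : Prop :=
  ∃ (ι : Fin p.1.1 ↪ Fin q.1.1) (s : Fin p.1.1 → ℤˣ) (c : Fin q.1.1 → ℤˣ),
    (∀ ε : Fin p.1.1 → ℤˣ, p.1.2 ε = q.1.2 (faceMap ι s c ε)) ∧
    (q.2 : Fin q.1.1 → ℝ) =
      faceMap ι (fun a => ((s a : ℤ) : ℝ)) (fun b => ((c b : ℤ) : ℝ)) (p.2 : Fin p.1.1 → ℝ)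

/-- The space obtained from a simple graph `G` by attaching, inductively for `k = 2, 3, …`, one
`k`-cube along every copy of the boundary of the `k`-cube in the `(k-1)`-skeleton, with the weak
topology. By induction each copy of the boundary of the `k`-cube in the `(k-1)`-skeleton consists
of the cubes already attached to the proper faces of a copy in `G` of the 1-skeleton of the
`k`-cube. So one takes a solid cube for each parametrized cube in `G` (for `k = 0` and `k = 1` these
are the vertices and edges of `G`) and glues along all face inclusions, including the symmetries
of the `k`-cube, which identify the different parametrizations of the same subgraph. -/
def CubeFilling {V : Type} (G : SimpleGraph V) : Type := Quot (IsGlued G)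

/-- The quotient topology from the disjoint union of all cubes. -/
instance {V : Type} (G : SimpleGraph V) : TopologicalSpace (CubeFilling G) :=
  inferInstanceAs (TopologicalSpace (Quot (IsGlued G)))

/-- The characteristic map of a parametrized cube. -/
def CubeFilling.charMap {V : Type} {G : SimpleGraph V} (f : ParamCube G) (x : SolidCube f.1) :
    CubeFilling G :=
  Quot.mk (IsGlued G) ⟨f, x⟩

/-! ### Cubical complexes, links, cubings -/

universe u

/-- A cubical complex: a Hausdorff space with a CW structure (characteristic maps are defined on
`[-1, 1]ᵏ`, the closed unit ball for the sup norm) such that the attaching map of every cell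
* maps each facet `{y | y a = σ}` of the cube isomorphically (by a linear isometry of
  `[-1, 1]ᵏ`, i.e. a signed permutation of the coordinates) onto a cell of one dimension lower;
* is a homeomorphism from the boundary of the cube onto its image. -/
structure CubicalComplex (X : Type u) [TopologicalSpace X] extends CWComplex (univ : Set X) where
  t2Space : T2Space X
  exists_facet : ∀ (k : ℕ) (i : cell (k + 1)) (a : Fin (k + 1)) (σ : ℤˣ),
    ∃ (j : cell k) (A : (Fin k → ℝ) ≃ₗᵢ[ℝ] (Fin k → ℝ)), ∀ x ∈ closedBall (0 : Fin k → ℝ) 1,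
      map (k + 1) i (Fin.insertNth (α := fun _ => ℝ) a ((σ : ℤ) : ℝ) x) = map k j (A x)
  isEmbedding_attach : ∀ (k : ℕ) (i : cell k),
    IsEmbedding ((sphere (0 : Fin k → ℝ) 1).domRestrict (map k i))

/-- A simplicial complex is flag if every nonempty collection of pairwise adjacent vertices spans
a simplex. -/
def AbstractSimplicialComplex.IsFlag {W : Type u} (L : AbstractSimplicialComplex W) : Prop :=
  ∀ S : Set W, S.Nonempty →
    (∀ v ∈ S, ∀ w ∈ S, v ≠ w → ∃ e ∈ L.faces, (e : Set W) = {v, w}) →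
    ∃ s ∈ L.faces, (s : Set W) = S

namespace CubicalComplex

variable {X : Type u} [TopologicalSpace X] (K : CubicalComplex X)

/-- The closed `k`-cube of the complex with index `i`. -/
def cube (k : ℕ) (i : K.cell k) : Set X := K.map k i '' closedBall 0 1

/-- The point of `X` given by a 0-cell. -/
def point (v : K.cell 0) : X := K.map 0 v 0

/-- The vertices of the link of `v`: the edges containing `v` (as attaching maps are injective,
an edge has only one end at `v`). -/
abbrev LinkVertex (v : K.cell 0) : Type u := {e : K.cell 1 // K.point v ∈ K.cube 1 e}

/-- The cubes of all dimensions containing `v`. As attaching maps are injective, such a cube has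
exactly one corner at `v`. -/
abbrev Star (v : K.cell 0) : Type u := {c : Σ k, K.cell k // K.point v ∈ K.cube c.1 c.2}

/-- The link of `v` in a `k`-cube containing `v` is a `(k-1)`-simplex; its vertices are given by
the edges of this cube at `v`. For `k = 0` it is empty. -/
def linkSimplex (v : K.cell 0) (c : K.Star v) : Set (K.LinkVertex v) :=
  {e | K.cube 1 e.1 ⊆ K.cube c.1.1 c.1.2}

/-- The link of `v`, the union of the links of `v` in all cubes containing `v`, is a flag simplicial
complex. That it is a simplicial complex means that the simplices coming from different cubes have
different sets of vertices, and that these vertex sets are the faces of an abstract simplicial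
complex. -/
def HasFlagLink (v : K.cell 0) : Prop :=
  Function.Injective (K.linkSimplex v) ∧
  ∃ L : AbstractSimplicialComplex (K.LinkVertex v),
    (∀ s : Finset (K.LinkVertex v),
      s ∈ L.faces ↔ s.Nonempty ∧ ∃ c : K.Star v, K.linkSimplex v c = (s : Set (K.LinkVertex v))) ∧
    L.IsFlag

/-- Gromov's link condition: all vertex links are flag complexes. -/
def IsNonpositivelyCurved : Prop := ∀ v : K.cell 0, K.HasFlagLink v

/-- A cubing is a simply connected nonpositively curved cubical complex. -/
structure IsCubing : Prop where
  simplyConnected : SimplyConnectedSpace X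
  nonpositivelyCurved : K.IsNonpositivelyCurved

end CubicalComplex

/-- The cubical structure `K` on `CubeFilling G` is the one from the construction: the `k`-cells
correspond bijectively to the copies in `G` of the 1-skeleton of the `k`-cube, and each
characteristic map is that of a parametrization of the corresponding copy. -/
def CubeFilling.IsStandard {V : Type} {G : SimpleGraph V} (K : CubicalComplex (CubeFilling G)) :
    Prop :=
  ∀ k : ℕ, ∃ e : K.cell k ≃ {H : G.Subgraph // Nonempty (cubeGraph k ≃g H.coe)},
    ∀ i : K.cell k, ∃ f : SimpleGraph.Copy (cubeGraph k) G, f.toSubgraph = (e i).1 ∧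
      ∀ x : SolidCube k, K.map k i x = CubeFilling.charMap ⟨k, f⟩ x

/-- The cubical complex `Xₙ`: the Cayley graph `𝓒ₙ` with all cubes filled. -/
abbrev HoughtonComplex (n : ℕ) : Type := CubeFilling (cayleyGraph n)

/-! Precomposition with translations of the rays is an action `tr` of `ℕⁿ` on the monoid. The
translation vector `shift` shows that the action is free. Any two elements have a common translate
(`exists_tr_eq_tr`), and an element is determined by its translates along two different rays
(`eq_of_tr_single_eq`). By this last fact a 4-cycle in the Cayley graph is always a square with
parallel opposite edges (`shift_square`). Hence every cube in the graph consists, up to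
parametrization, of the translates of a lowest vertex along a set of rays (`exists_eq_cubeAt`).

So the complex is a union of orthants, one for each element `α`, parametrized by `pt α`; the orthant
of a translate of `α` is a shifted part of the orthant of `α`. Every point is `pt α v` for exactly
one pair with `v ∈ [0,1)ⁿ` (`exists_pt_eq`, `pt_injective`). Uniqueness and the Hausdorff property
come from continuous functions that extend functions on the vertices multi-affinely over the cubes:
the shifts give `height`, with values in `ℝⁿ`, and indicators of vertices separate points of equal
height. Cells are pairs of a lowest vertex and a set of directions, and `height` inverts their
characteristic maps.

For simple connectivity, the flow that increases all coordinates is homotopic to the identity.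
Because of common translates it carries any compact set into one prescribed orthant after a finite
time. An orthant is a copy of `[0,∞)ⁿ` with inverse given by `height`, so a loop in it factors
through `ℝⁿ` and contracts.

For the links, an edge at `α` either goes up from `α` to `tᵢ α`, or comes up from some `β` with `tᵢ
β = α`. Such a `β` inserts one value outside the image of `α` at the start of ray `i`. Edges at `α`
span a cube exactly when their labels differ and the inserted values differ, since then all values
can be inserted at once into an injective map (`exists_tr_ind_eq`, `exists_cube_of_pairwise`). This
condition is pairwise, so the link is flag; `eq_of_tr_erase_eq` shows that a cube is determined by
its edges at `α`. -/

/-! ### The action of `ℕⁿ` on the monoid -/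

namespace HoughtonMonoid

variable {n : ℕ}

/-- `tr a α` is `t₁^{a₁} ⋯ tₙ^{aₙ} α`: the first `a k` values on the `k`-th ray are removed. -/
def tr (a : Fin n → ℕ) (α : HoughtonMonoid n) : HoughtonMonoid n :=
  ⟨fun y => α.1 (y.1, y.2 + a y.1), by
    rintro ⟨k, p⟩ ⟨l, q⟩ h
    have := α.2.1 h
    simp only [Prod.mk.injEq] at this ⊢
    obtain ⟨rfl, h2⟩ := this
    exact ⟨rfl, by omega⟩, by
    obtain ⟨hinj, m, K, hK⟩ := α.2
    have hi : Function.Injective (fun y : Rays n => (y.1, y.2 + a y.1)) := by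
      rintro ⟨k, p⟩ ⟨l, q⟩ h
      simp only [Prod.mk.injEq] at h ⊢
      obtain ⟨rfl, h2⟩ := h
      exact ⟨rfl, by omega⟩
    refine ⟨fun k => m k + a k, K.preimage _ hi.injOn, fun k p hkp => ?_⟩
    obtain ⟨h1, h2⟩ := hK k (p + a k) (by simpa using hkp)
    refine ⟨h1, ?_⟩
    rw [h2]
    push_cast
    ring⟩

theorem tr_apply (a : Fin n → ℕ) (α : HoughtonMonoid n) (k : Fin n) (p : ℕ) :
    (tr a α).1 (k, p) = α.1 (k, p + a k) := rfl

@[ext]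
theorem ext {α β : HoughtonMonoid n} (h : ∀ k p, α.1 (k, p) = β.1 (k, p)) : α = β :=
  Subtype.ext (funext fun y => h y.1 y.2)

@[simp]
theorem tr_zero (α : HoughtonMonoid n) : tr 0 α = α := rfl

theorem tr_tr (a b : Fin n → ℕ) (α : HoughtonMonoid n) : tr a (tr b α) = tr (a + b) α := by
  ext k p <;> simp [tr_apply, add_assoc]

theorem t_mul (i : Fin n) (α : HoughtonMonoid n) : t i * α = tr (Pi.single i 1) α := by
  refine ext fun k p => ?_
  rw [mul_apply, tr_apply]
  by_cases h : k = i
  · subst h; simp [t]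
  · simp [t, h]

theorem exists_translation (α : HoughtonMonoid n) :
    ∃ (m : Fin n → ℤ) (N : ℕ), ∀ k p, N ≤ p →
      (α.1 (k, p)).1 = k ∧ ((α.1 (k, p)).2 : ℤ) = p + m k := by
  obtain ⟨-, m, K, hK⟩ := α.2
  refine ⟨m, K.sup (fun y => y.2 + 1), fun k p hp => hK k p fun h => ?_⟩
  have := Finset.le_sup (f := fun y : Rays n => y.2 + 1) h
  simp only at this
  omega

/-- The translation vector of an eventual translation. -/
noncomputable def shift (α : HoughtonMonoid n) : Fin n → ℤ := α.exists_translation.choose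

theorem exists_shift (α : HoughtonMonoid n) : ∃ N : ℕ, ∀ k p, N ≤ p →
    (α.1 (k, p)).1 = k ∧ ((α.1 (k, p)).2 : ℤ) = p + α.shift k :=
  α.exists_translation.choose_spec

theorem shift_tr (a : Fin n → ℕ) (α : HoughtonMonoid n) (k : Fin n) :
    (tr a α).shift k = α.shift k + a k := by
  obtain ⟨N, hN⟩ := α.exists_shift
  obtain ⟨N', hN'⟩ := (tr a α).exists_shift
  have h1 := (hN' k (N + N') (by omega)).2
  have h2 := (hN k (N + N' + a k) (by omega)).2
  rw [tr_apply, h2] at h1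
  push_cast at h1
  linarith

theorem tr_left_injective (α : HoughtonMonoid n) : Function.Injective (fun a => tr a α) := by
  intro a b h
  funext k
  have := congrArg (fun β => shift β k) h
  simp only [shift_tr] at this
  omega

theorem tr_eq_self {a : Fin n → ℕ} {α : HoughtonMonoid n} (h : tr a α = α) : a = 0 :=
  tr_left_injective α h

/-- Any two elements have a common translate. -/
theorem exists_tr_eq_tr (α β : HoughtonMonoid n) :
    ∃ (N : ℕ) (b : Fin n → ℕ), tr (fun _ => N) α = tr b β := by
  obtain ⟨N, hN⟩ := α.exists_shift
  obtain ⟨N', hN'⟩ := β.exists_shift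
  obtain ⟨C, hC⟩ : ∃ C : ℕ, ∀ k, α.shift k - β.shift k + C ≥ 0 := by
    refine ⟨∑ k, (α.shift k - β.shift k).natAbs, fun k => ?_⟩
    have := Finset.single_le_sum (f := fun k => (α.shift k - β.shift k).natAbs)
      (fun _ _ => Nat.zero_le _) (Finset.mem_univ k)
    omega
  -- Dropping `N + N'` values passes both exceptional sets; the remaining terms equalize the shifts,
  -- with `C` keeping the correction for `β` nonnegative.
  refine ⟨N + N' + C, fun k => N + N' + (α.shift k - β.shift k + C).toNat, ext fun k p => ?_⟩
  have e : ((α.shift k - β.shift k + C).toNat : ℤ) = α.shift k - β.shift k + C :=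
    Int.toNat_of_nonneg (hC k)
  obtain ⟨h1, h2⟩ := hN k (p + (N + N' + C)) (by omega)
  obtain ⟨h3, h4⟩ := hN' k (p + (N + N' + (α.shift k - β.shift k + C).toNat)) (by omega)
  rw [tr_apply, tr_apply]
  refine Prod.ext (h1.trans h3.symm) ?_
  push_cast at h2 h4
  omega

/-- Two elements agree if they become equal after translation along two different rays. -/
theorem eq_of_tr_single_eq {α β : HoughtonMonoid n} {i j : Fin n} (hij : i ≠ j)
    (hi : tr (Pi.single i 1) α = tr (Pi.single i 1) β)
    (hj : tr (Pi.single j 1) α = tr (Pi.single j 1) β) : α = β := by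
  refine ext fun k p => ?_
  -- The values on ray `k` are unchanged by a translation along any other ray, and one of `i`, `j`
  -- differs from `k`.
  by_cases h : k = i
  · subst h
    simpa [tr_apply, hij] using congrArg (fun γ => γ.1 (k, p)) hj
  · simpa [tr_apply, h] using congrArg (fun γ => γ.1 (k, p)) hi

theorem adj_iff {α β : HoughtonMonoid n} : (cayleyGraph n).Adj α β ↔
    ∃ i, β = tr (Pi.single i 1) α ∨ α = tr (Pi.single i 1) β := by
  simp only [cayleyGraph, SimpleGraph.fromRel_adj, t_mul]
  constructor
  · rintro ⟨-, ⟨i, h⟩ | ⟨i, h⟩⟩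
    exacts [⟨i, Or.inl h⟩, ⟨i, Or.inr h⟩]
  · rintro ⟨i, h | h⟩
    · refine ⟨fun e => ?_, Or.inl ⟨i, h⟩⟩
      rw [e, ← t_mul] at h
      exact t_mul_ne i β h.symm
    · refine ⟨fun e => ?_, Or.inr ⟨i, h⟩⟩
      rw [e, ← t_mul] at h
      exact t_mul_ne i β h.symm

/-- The difference of shifts along an edge is plus or minus a basis vector, so it reveals both the
label and the orientation. -/
theorem eq_tr_of_adj {α β : HoughtonMonoid n} (h : (cayleyGraph n).Adj α β) {i : Fin n}
    (hi : β.shift - α.shift = Pi.single i 1) : β = tr (Pi.single i 1) α := by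
  obtain ⟨j, rfl | rfl⟩ := adj_iff.1 h
  · by_cases hij : i = j
    · rw [hij]
    · simpa [shift_tr, hij] using congrFun hi i
  · have := congrFun hi j
    by_cases hij : j = i <;> simp [shift_tr, hij] at this

theorem shift_sub_shift_of_adj {α β : HoughtonMonoid n} (h : (cayleyGraph n).Adj α β) :
    ∃ (i : Fin n) (s : ℤˣ), β.shift - α.shift = Pi.single i (s : ℤ) := by
  obtain ⟨i, rfl | rfl⟩ := adj_iff.1 h
  · refine ⟨i, 1, funext fun k => ?_⟩
    by_cases hk : k = i
    · subst hk; simp [shift_tr]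
    · simp [shift_tr, hk]
  · refine ⟨i, -1, funext fun k => ?_⟩
    by_cases hk : k = i
    · subst hk; simp [shift_tr]
    · simp [shift_tr, hk]

theorem shift_tr_single (i : Fin n) (α : HoughtonMonoid n) :
    (tr (Pi.single i 1) α).shift = α.shift + Pi.single i 1 := by
  funext k
  by_cases hk : k = i
  · subst hk; simp [shift_tr]
  · simp [shift_tr, hk]

theorem single_add_single_eq {i j k l : Fin n}
    (h : (Pi.single i 1 + Pi.single j 1 : Fin n → ℤ) = Pi.single k 1 + Pi.single l 1) :
    (i = k ∧ j = l) ∨ (i = l ∧ j = k) := by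
  have hi := congrFun h i
  have hj := congrFun h j
  have hk := congrFun h k
  simp only [Pi.add_apply, Pi.single_apply] at hi hj hk
  grind

/-- In a 4-cycle of the Cayley graph opposite edges have the same label and orientation, and
adjacent edges have different labels. -/
theorem shift_square {α₀₀ α₁₀ α₀₁ α₁₁ : HoughtonMonoid n}
    (h1 : (cayleyGraph n).Adj α₀₀ α₁₀) (h2 : (cayleyGraph n).Adj α₀₀ α₀₁)
    (h3 : (cayleyGraph n).Adj α₁₀ α₁₁) (h4 : (cayleyGraph n).Adj α₀₁ α₁₁)
    (hd : α₀₀ ≠ α₁₁) (hd' : α₁₀ ≠ α₀₁) :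
    α₁₁.shift - α₀₁.shift = α₁₀.shift - α₀₀.shift ∧
    ∃ (i j : Fin n) (s r : ℤˣ), α₁₀.shift - α₀₀.shift = Pi.single i (s : ℤ) ∧
      α₀₁.shift - α₀₀.shift = Pi.single j (r : ℤ) ∧ i ≠ j := by
  have key : ∀ {u v x y : HoughtonMonoid n} {i j : Fin n},
      u ≠ v → x = tr (Pi.single i 1) u → x = tr (Pi.single i 1) v →
      y = tr (Pi.single j 1) u → y = tr (Pi.single j 1) v → i = j := by
    intro u v x y i j huv e1 e2 e3 e4
    by_contra hij
    exact huv (eq_of_tr_single_eq hij (e1.symm.trans e2) (e3.symm.trans e4))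
  have deg : ∀ {u v : HoughtonMonoid n} {i : Fin n}, v = tr (Pi.single i 1) u →
      ∑ k, v.shift k = ∑ k, u.shift k + 1 := by
    rintro u v i rfl
    simp [shift_tr_single, Finset.sum_add_distrib]
  have sh : ∀ {u v : HoughtonMonoid n} {i : Fin n}, v = tr (Pi.single i 1) u →
      v.shift = u.shift + Pi.single i 1 := by
    rintro u v i rfl
    exact shift_tr_single i u
  -- The sum of the shift changes by one along each edge, so only six of the sixteen orientation
  -- patterns survive. Four have one source and one sink and are genuine squares; the two with two
  -- sources and two sinks contradict `key` or the distinctness of opposite corners.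
  obtain ⟨i, e1 | e1⟩ := adj_iff.1 h1 <;> obtain ⟨j, e2 | e2⟩ := adj_iff.1 h2 <;>
    obtain ⟨k, e3 | e3⟩ := adj_iff.1 h3 <;> obtain ⟨l, e4 | e4⟩ := adj_iff.1 h4 <;>
    have d1 := deg e1 <;> have d2 := deg e2 <;> have d3 := deg e3 <;> have d4 := deg e4 <;>
    try omega
  all_goals
    clear d1 d2 d3 d4
    have s1 := sh e1
    have s2 := sh e2
    have s3 := sh e3
    have s4 := sh e4
  · have hij : i ≠ j := by rintro rfl; exact hd' (e1.trans e2.symm)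
    rcases single_add_single_eq (i := i) (j := k) (k := j) (l := l)
      (by linear_combination (exp := 1) s4 - s3 + s2 - s1) with ⟨h, -⟩ | ⟨rfl, rfl⟩
    · exact absurd h hij
    · exact ⟨by rw [s4, s1]; abel, i, k, 1, 1, by rw [s1]; simp, by rw [s2]; simp, hij⟩
  · have hij : i ≠ j := by rintro rfl; exact hd' (e1.trans e2.symm)
    rcases single_add_single_eq (i := i) (j := l) (k := j) (l := k)
      (by linear_combination (exp := 1) s3 - s1 + s2 - s4) with ⟨h, -⟩ | ⟨rfl, rfl⟩
    · exact absurd h hij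
    · exact absurd (key hd e1 e3 e2 e4) hij
  · rcases single_add_single_eq (i := i) (j := j) (k := k) (l := l)
      (by linear_combination (exp := 1) s3 - s1 + s4 - s2) with ⟨rfl, rfl⟩ | ⟨rfl, rfl⟩
    · exact absurd (e2.trans e4.symm) hd
    · refine ⟨by rw [s4, s1]; abel, i, j, 1, -1, by rw [s1]; simp, ?_, ?_⟩
      · rw [s2]
        simp [Pi.single_neg]
      · rintro rfl
        exact hd (e2.trans e4.symm)
  · rcases single_add_single_eq (i := i) (j := j) (k := k) (l := l)
      (by linear_combination (exp := 1) s3 - s1 + s4 - s2) with ⟨rfl, rfl⟩ | ⟨rfl, rfl⟩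
    · exact absurd (e1.trans e3.symm) hd
    · refine ⟨by rw [s4, s1]; abel, i, j, -1, 1, ?_, by rw [s2]; simp, ?_⟩
      · rw [s1]
        simp [Pi.single_neg]
      · rintro rfl
        exact hd (e1.trans e3.symm)
  · rcases single_add_single_eq (i := k) (j := j) (k := l) (l := i)
      (by linear_combination (exp := 1) s1 - s2 - s3 + s4) with ⟨rfl, rfl⟩ | ⟨rfl, rfl⟩
    · have := key hd' e1 e2 e3 e4
      subst this
      exact absurd (e1.trans e3.symm) hd
    · exact absurd (e1.trans e3.symm) hd
  · have hij : i ≠ j := by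
      rintro rfl
      rcases single_add_single_eq (i := k) (j := i) (k := l) (l := i)
        (by linear_combination (exp := 1) s2 - s1 - s3 + s4) with ⟨rfl, -⟩ | ⟨rfl, rfl⟩ <;>
        exact hd' (e3.trans e4.symm)
    rcases single_add_single_eq (i := i) (j := k) (k := j) (l := l)
      (by linear_combination (exp := 1) s2 - s1 - s3 + s4) with ⟨h, -⟩ | ⟨rfl, rfl⟩
    · exact absurd h hij
    · refine ⟨by rw [s4, s1]; abel, i, k, -1, -1, ?_, ?_, hij⟩
      · rw [s1]; simp [Pi.single_neg]
      · rw [s2]; simp [Pi.single_neg]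

end HoughtonMonoid

/-! ### Cubes in the Cayley graph -/

theorem units_int_eq_neg_of_ne {u v : ℤˣ} (h : u ≠ v) : v = -u := by
  rcases Int.units_eq_one_or u with rfl | rfl <;> rcases Int.units_eq_one_or v with rfl | rfl <;>
    simp_all

theorem units_int_ne_neg (u : ℤˣ) : u ≠ -u := by
  rcases Int.units_eq_one_or u with rfl | rfl <;> decide

theorem cubeGraph_adj_iff {k : ℕ} {u v : Fin k → ℤˣ} :
    (cubeGraph k).Adj u v ↔ ∃ a, v = Function.update u a (-u a) := by
  change hammingDist u v = 1 ↔ _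
  unfold hammingDist
  rw [Finset.card_eq_one]
  refine exists_congr fun a => ⟨fun h => funext fun b => ?_, ?_⟩
  · have hb := Finset.ext_iff.1 h b
    simp only [Finset.mem_filter, Finset.mem_univ, true_and, Finset.mem_singleton] at hb
    by_cases hba : b = a
    · subst hba
      rw [Function.update_self]
      exact units_int_eq_neg_of_ne (hb.2 rfl)
    · rw [Function.update_of_ne hba]
      by_contra hne
      exact hba (hb.1 fun h => hne h.symm)
  · rintro rfl
    ext b
    by_cases hba : b = a
    · subst hba
      simp
    · simp [hba]

theorem cubeGraph_adj_update {k : ℕ} (u : Fin k → ℤˣ) (a : Fin k) {c : ℤˣ} (h : c ≠ u a) :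
    (cubeGraph k).Adj u (Function.update u a c) :=
  cubeGraph_adj_iff.2 ⟨a, by rw [units_int_eq_neg_of_ne h.symm]⟩

/-- A function that does not change when single coordinates are changed is constant. -/
theorem eq_of_forall_update_eq {k : ℕ} {R Z : Type} {F : (Fin k → R) → Z}
    (h : ∀ x a c, F (Function.update x a c) = F x) (x y : Fin k → R) : F x = F y := by
  classical
  have key : ∀ A : Finset (Fin k), F (A.piecewise x y) = F y := by
    intro A
    induction A using Finset.induction_on with
    | empty => simp
    | insert a A ha ih => rw [Finset.piecewise_insert, h, ih]
  simpa using key Finset.univ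

theorem exists_finset_piecewise_eq {k : ℕ} (ε : Fin k → ℤˣ) :
    ∃ A : Finset (Fin k), ε = A.piecewise 1 (-1) := by
  refine ⟨Finset.univ.filter fun a => ε a = 1, funext fun a => ?_⟩
  rcases Int.units_eq_one_or (ε a) with h | h <;> simp [Finset.piecewise, h]

/-- The indicator vector of the image under `ι` of the set of positive entries of `ε`. -/
noncomputable def cubeVec {k n : ℕ} (ι : Fin k ↪ Fin n) (ε : Fin k → ℤˣ) : Fin n → ℕ :=
  Function.extend ι (fun a => if ε a = 1 then 1 else 0) 0

section cubeVec

variable {k n : ℕ} (ι : Fin k ↪ Fin n)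

theorem cubeVec_apply (ε : Fin k → ℤˣ) (a : Fin k) :
    cubeVec ι ε (ι a) = if ε a = 1 then 1 else 0 := ι.injective.extend_apply _ _ _

theorem cubeVec_of_notMem (ε : Fin k → ℤˣ) {i : Fin n} (hi : i ∉ range ι) : cubeVec ι ε i = 0 :=
  Function.extend_apply' _ _ _ fun ⟨a, ha⟩ => hi ⟨a, ha⟩

theorem cubeVec_update_one (ε : Fin k → ℤˣ) (a : Fin k) :
    cubeVec ι (Function.update ε a 1) =
      Pi.single (ι a) 1 + cubeVec ι (Function.update ε a (-1)) := by
  funext i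
  by_cases hi : i ∈ range ι
  · obtain ⟨b, rfl⟩ := hi
    by_cases hb : b = a
    · subst hb; simp [cubeVec_apply]
    · simp [cubeVec_apply, hb]
  · have : i ≠ ι a := fun h => hi ⟨a, h.symm⟩
    simp [cubeVec_of_notMem ι _ hi, this]

theorem cubeVec_neg_one : cubeVec ι (-1) = 0 := by
  funext i
  by_cases hi : i ∈ range ι
  · obtain ⟨b, rfl⟩ := hi
    simp [cubeVec_apply]
  · exact cubeVec_of_notMem ι _ hi

theorem cubeVec_injective : Function.Injective (cubeVec ι) := by
  intro ε ε' h
  funext a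
  have := congrFun h (ι a)
  rw [cubeVec_apply, cubeVec_apply] at this
  rcases Int.units_eq_one_or (ε a) with h | h <;> rcases Int.units_eq_one_or (ε' a) with h' | h' <;>
    simp_all

end cubeVec

namespace HoughtonMonoid

variable {k n : ℕ}

/-- The cube with lowest vertex `α` and the directions given by `ι`. -/
noncomputable def cubeAt (α : HoughtonMonoid n) (ι : Fin k ↪ Fin n) :
    SimpleGraph.Copy (cubeGraph k) (cayleyGraph n) where
  toHom := ⟨fun ε => tr (cubeVec ι ε) α, by
    intro ε ε' h
    obtain ⟨a, rfl⟩ := cubeGraph_adj_iff.1 h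
    rw [adj_iff]
    refine ⟨ι a, ?_⟩
    have key := cubeVec_update_one ι ε a
    rcases Int.units_eq_one_or (ε a) with h | h
    · right
      have e : Function.update ε a 1 = ε := by rw [← h, Function.update_eq_self]
      rw [e] at key
      rw [tr_tr, h, ← key]
    · left
      have e : Function.update ε a (-1) = ε := by rw [← h, Function.update_eq_self]
      rw [e] at key
      rw [tr_tr, h, neg_neg, ← key]⟩
  injective' := fun _ _ h => cubeVec_injective ι (tr_left_injective α h)

@[simp]
theorem cubeAt_apply (α : HoughtonMonoid n) (ι : Fin k ↪ Fin n) (ε : Fin k → ℤˣ) :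
    cubeAt α ι ε = tr (cubeVec ι ε) α := rfl

/-- This is `shift_square` on a 2-face of the cube; injectivity of the copy makes opposite corners
distinct. -/
theorem copy_square (f : SimpleGraph.Copy (cubeGraph k) (cayleyGraph n)) (ε : Fin k → ℤˣ)
    {a b : Fin k} (hab : a ≠ b) {c d : ℤˣ} (hc : c ≠ ε a) (hd : d ≠ ε b) :
    (f (Function.update (Function.update ε b d) a c)).shift - (f (Function.update ε b d)).shift =
      (f (Function.update ε a c)).shift - (f ε).shift ∧
    ∃ (i j : Fin n) (s r : ℤˣ),
      (f (Function.update ε a c)).shift - (f ε).shift = Pi.single i (s : ℤ) ∧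
      (f (Function.update ε b d)).shift - (f ε).shift = Pi.single j (r : ℤ) ∧ i ≠ j := by
  have adj : ∀ (η : Fin k → ℤˣ) (a : Fin k) {c : ℤˣ}, c ≠ η a →
      (cayleyGraph n).Adj (f η) (f (Function.update η a c)) := fun η a c h =>
    f.toHom.map_adj (cubeGraph_adj_update η a h)
  refine shift_square (adj ε a hc) (adj ε b hd) ?_ (adj _ a ?_) ?_ ?_
  · rw [Function.update_comm hab.symm]
    exact adj _ b (by rwa [Function.update_of_ne hab.symm])
  · rwa [Function.update_of_ne hab]
  · intro h
    have := congrFun (f.injective h) a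
    simp [hc.symm] at this
  · intro h
    have := congrFun (f.injective h) a
    simp [hab, hc] at this

/-- Every cube in the Cayley graph is a reparametrization of one of the cubes `cubeAt α ι`. -/
theorem exists_eq_cubeAt (f : SimpleGraph.Copy (cubeGraph k) (cayleyGraph n)) :
    ∃ (α : HoughtonMonoid n) (ι : Fin k ↪ Fin n) (s : Fin k → ℤˣ),
      ∀ ε, f ε = cubeAt α ι (s * ε) := by
  classical
  -- All edges in direction `a` are parallel: changing another coordinate moves such an edge to the
  -- opposite side of a square.
  have hD : ∀ (a : Fin k) (ε ε' : Fin k → ℤˣ),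
      (f (Function.update ε a 1)).shift - (f (Function.update ε a (-1))).shift =
      (f (Function.update ε' a 1)).shift - (f (Function.update ε' a (-1))).shift := by
    intro a
    refine eq_of_forall_update_eq (F := fun ε => (f (Function.update ε a 1)).shift -
      (f (Function.update ε a (-1))).shift) fun ε b c => ?_
    by_cases hba : b = a
    · subst hba
      simp
    by_cases hc : c = ε b
    · subst hc
      simp
    have := (copy_square f (Function.update ε a (-1)) (Ne.symm hba) (c := 1) (d := c)
      (by simp) (by simpa [hba] using hc)).1
    simp only [Function.update_comm hba, Function.update_idem] at this ⊢
    exact this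
  have hlabel : ∀ a : Fin k, ∃ (i : Fin n) (s : ℤˣ),
      (f (Function.update (-1) a 1)).shift - (f (-1)).shift = Pi.single i (s : ℤ) := fun a =>
    shift_sub_shift_of_adj (f.toHom.map_adj (cubeGraph_adj_update _ a (by simp)))
  choose ι s hs using hlabel
  have hι : Function.Injective ι := by
    intro a b hab
    by_contra hne'
    obtain ⟨-, i, j, s', r, h1, h2, hij⟩ := copy_square f (-1) hne' (c := 1) (d := 1)
      (by simp) (by simp)
    rw [hs] at h1 h2
    have aux : ∀ {i j : Fin n} {s r : ℤˣ}, (Pi.single i (s : ℤ) : Fin n → ℤ) = Pi.single j ↑r →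
        i = j := by
      intro i j s r h
      by_contra hij
      simpa [hij] using congrFun h i
    exact hij ((aux h1).symm.trans (hab.trans (aux h2)))
  have hD' : ∀ a ε, (f (Function.update ε a 1)).shift - (f (Function.update ε a (-1))).shift =
      Pi.single (ι a) (s a : ℤ) := by
    intro a ε
    rw [hD a ε (-1), ← hs a]
    congr 3
    exact Function.update_eq_self a (-1 : Fin k → ℤˣ)
  have hstep : ∀ a ε, ε a = -s a →
      f (Function.update ε a (s a)) = tr (Pi.single (ι a) 1) (f ε) := by
    intro a ε hε
    refine eq_tr_of_adj (f.toHom.map_adj (cubeGraph_adj_update ε a ?_)) ?_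
    · rw [hε]; exact units_int_ne_neg _
    · have e : f ε = f (Function.update ε a (-s a)) := by rw [← hε, Function.update_eq_self]
      change (f (Function.update ε a (s a))).shift - (f ε).shift = _
      rw [e]
      rcases Int.units_eq_one_or (s a) with h | h
      · simpa [h] using hD' a ε
      · rw [← neg_inj, neg_sub]
        simpa [h, Pi.single_neg] using hD' a ε
  -- The sign `s a` is the value of coordinate `a` at the upper ends of the edges in direction `a`,
  -- so `-s` is the lowest vertex. The induction below raises the coordinates one at a time.
  refine ⟨f (-s), ⟨ι, hι⟩, s, fun ε => ?_⟩
  have key : ∀ A : Finset (Fin k),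
      f (A.piecewise s (-s)) = tr (cubeVec ⟨ι, hι⟩ (A.piecewise 1 (-1))) (f (-s)) := by
    intro A
    induction A using Finset.induction_on with
    | empty => simp [cubeVec_neg_one]
    | insert a A ha ih =>
      rw [Finset.piecewise_insert, Finset.piecewise_insert, hstep a _ (by simp [ha]), ih, tr_tr,
        Pi.one_apply, cubeVec_update_one]
      congr 3
      conv_rhs => rw [← Function.update_eq_self a (A.piecewise (1 : Fin k → ℤˣ) (-1))]
      simp [ha]
  obtain ⟨A, hA⟩ := exists_finset_piecewise_eq (s * ε)
  have hε : ε = A.piecewise s (-s) := by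
    have : ε = s * (s * ε) := by
      funext a
      simp [← mul_assoc]
    rw [this, hA]
    funext a
    by_cases h : a ∈ A <;> simp [h]
  rw [cubeAt_apply, hA, ← key, ← hε]

end HoughtonMonoid

/-! ### Interpolation of functions on the vertices -/

/-- The coordinates of a vertex of the cube, as real numbers. -/
def signVec {k : ℕ} (ε : Fin k → ℤˣ) : Fin k → ℝ := fun a => ((ε a : ℤ) : ℝ)

theorem cast_units_eq_or (u : ℤˣ) : ((u : ℤ) : ℝ) = 1 ∨ ((u : ℤ) : ℝ) = -1 := by
  rcases Int.units_eq_one_or u with rfl | rfl <;> simp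

section faceMap

variable {R : Type} [Mul R] {j k : ℕ} (ι : Fin j ↪ Fin k) (s : Fin j → R) (c : Fin k → R)

theorem faceMap_apply (x : Fin j → R) (a : Fin j) : faceMap ι s c x (ι a) = s a * x a :=
  ι.injective.extend_apply _ _ _

theorem faceMap_of_notMem (x : Fin j → R) {b : Fin k} (hb : b ∉ range ι) :
    faceMap ι s c x b = c b :=
  Function.extend_apply' _ _ _ fun ⟨a, ha⟩ => hb ⟨a, ha⟩

theorem faceMap_update (x : Fin j → R) (a : Fin j) (u : R) :
    faceMap ι s c (Function.update x a u) = Function.update (faceMap ι s c x) (ι a) (s a * u) := by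
  funext b
  by_cases hb : b ∈ range ι
  · obtain ⟨a', rfl⟩ := hb
    by_cases h : a' = a
    · subst h; simp [faceMap_apply]
    · simp [faceMap_apply, h]
  · have : b ≠ ι a := fun h => hb ⟨a, h.symm⟩
    simp [faceMap_of_notMem ι s c _ hb, this]

end faceMap

theorem signVec_faceMap {j k : ℕ} (ι : Fin j ↪ Fin k) (s : Fin j → ℤˣ) (c : Fin k → ℤˣ)
    (ε : Fin j → ℤˣ) :
    signVec (faceMap ι s c ε) = faceMap ι (signVec s) (signVec c) (signVec ε) := by
  funext b
  by_cases hb : b ∈ range ι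
  · obtain ⟨a, rfl⟩ := hb
    simp [signVec, faceMap_apply]
  · simp [signVec, faceMap_of_notMem _ _ _ _ hb]

/-- A function on `ℝᵏ` that is affine in each coordinate. -/
def IsMultiAffine {k : ℕ} (F : (Fin k → ℝ) → ℝ) : Prop :=
  ∀ x a u, F (Function.update x a u) =
    (1 + u) / 2 * F (Function.update x a 1) + (1 - u) / 2 * F (Function.update x a (-1))

theorem IsMultiAffine.ext {k : ℕ} {F G : (Fin k → ℝ) → ℝ} (hF : IsMultiAffine F)
    (hG : IsMultiAffine G) (h : ∀ ε, F (signVec ε) = G (signVec ε)) : F = G := by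
  -- Induction on the set `A` of coordinates that need not be signs; affineness in one of them
  -- reduces to its two extreme values.
  have key : ∀ (A : Finset (Fin k)) (x : Fin k → ℝ), (∀ a ∉ A, ∃ u : ℤˣ, x a = ((u : ℤ) : ℝ)) →
      F x = G x := by
    intro A
    induction A using Finset.induction_on with
    | empty =>
      intro x hx
      choose ε hε using fun a => hx a (Finset.notMem_empty a)
      have : x = signVec ε := funext hε
      rw [this, h]
    | insert a A ha ih =>
      intro x hx
      have hu : ∀ u : ℤˣ, F (Function.update x a u) = G (Function.update x a u) := by
        refine fun u => ih _ fun b hb => ?_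
        by_cases hba : b = a
        · subst hba
          exact ⟨u, by simp⟩
        · rw [Function.update_of_ne hba]
          exact hx b (by simp [hba, hb])
      have h1 := hu 1
      have h2 := hu (-1)
      simp only [Units.val_neg, Units.val_one, Int.cast_neg, Int.cast_one] at h1 h2
      rw [← Function.update_eq_self a x, hF, hG, h1, h2]
  funext x
  exact key Finset.univ x fun a ha => absurd (Finset.mem_univ a) ha

/-- The weight of the vertex `ε` of the cube at the point `x`. -/
noncomputable def vertexWeight {k : ℕ} (ε : Fin k → ℤˣ) (x : Fin k → ℝ) : ℝ :=
  ∏ a, (1 + ((ε a : ℤ) : ℝ) * x a) / 2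

/-- The extension of a function on the vertices of the cube that is affine in each coordinate. -/
noncomputable def interp {k : ℕ} (φ : (Fin k → ℤˣ) → ℝ) (x : Fin k → ℝ) : ℝ :=
  ∑ ε, vertexWeight ε x * φ ε

theorem continuous_interp {k : ℕ} (φ : (Fin k → ℤˣ) → ℝ) : Continuous (interp φ) := by
  unfold interp vertexWeight
  fun_prop

theorem isMultiAffine_interp {k : ℕ} (φ : (Fin k → ℤˣ) → ℝ) : IsMultiAffine (interp φ) := by
  intro x a u
  simp only [interp, Finset.mul_sum, ← Finset.sum_add_distrib]
  refine Finset.sum_congr rfl fun ε _ => ?_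
  have h : ∀ v, vertexWeight ε (Function.update x a v) = (1 + ((ε a : ℤ) : ℝ) * v) / 2 *
      ∏ b ∈ Finset.univ.erase a, (1 + ((ε b : ℤ) : ℝ) * x b) / 2 := by
    intro v
    rw [vertexWeight, ← Finset.mul_prod_erase _ _ (Finset.mem_univ a), Function.update_self]
    congr 1
    refine Finset.prod_congr rfl fun b hb => ?_
    rw [Function.update_of_ne (Finset.ne_of_mem_erase hb)]
  simp only [h]
  ring

theorem vertexWeight_signVec {k : ℕ} (ε η : Fin k → ℤˣ) :
    vertexWeight ε (signVec η) = if ε = η then 1 else 0 := by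
  split_ifs with h
  · subst h
    refine Finset.prod_eq_one fun a _ => ?_
    rcases Int.units_eq_one_or (ε a) with h | h <;> simp [signVec, h]
  · obtain ⟨a, ha⟩ := Function.ne_iff.1 h
    refine Finset.prod_eq_zero (Finset.mem_univ a) ?_
    rw [signVec, units_int_eq_neg_of_ne ha]
    rcases Int.units_eq_one_or (ε a) with h | h <;> simp [h]

theorem interp_signVec {k : ℕ} (φ : (Fin k → ℤˣ) → ℝ) (ε : Fin k → ℤˣ) :
    interp φ (signVec ε) = φ ε := by
  simp [interp, vertexWeight_signVec]

theorem interp_eq_of_isMultiAffine {k : ℕ} {F : (Fin k → ℝ) → ℝ} (hF : IsMultiAffine F)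
    {φ : (Fin k → ℤˣ) → ℝ} (h : ∀ ε, φ ε = F (signVec ε)) : interp φ = F :=
  (isMultiAffine_interp φ).ext hF fun ε => by rw [interp_signVec, h]

/-- Each variable enters a face inclusion through a single coordinate and up to sign, so both sides
are multi-affine and agree at the vertices. This makes interpolation compatible with the gluing. -/
theorem interp_faceMap {j k : ℕ} (ι : Fin j ↪ Fin k) (s : Fin j → ℤˣ) (c : Fin k → ℤˣ)
    (φ : (Fin k → ℤˣ) → ℝ) (x : Fin j → ℝ) :
    interp (fun ε => φ (faceMap ι s c ε)) x =
      interp φ (faceMap ι (signVec s) (signVec c) x) := by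
  have hF : IsMultiAffine fun x => interp φ (faceMap ι (signVec s) (signVec c) x) := by
    intro x a u
    have h := isMultiAffine_interp φ (faceMap ι (signVec s) (signVec c) x) (ι a)
    simp only [faceMap_update]
    rcases cast_units_eq_or (s a) with hs | hs
    · simp only [signVec, hs, one_mul] at h ⊢
      exact h u
    · simp only [signVec, hs, neg_mul, one_mul, neg_neg] at h ⊢
      rw [h]
      ring
  exact congrFun (interp_eq_of_isMultiAffine hF fun ε => by
    simp only [← signVec_faceMap, interp_signVec]) x

/-! ### Extending functions from the vertices to the complex -/

namespace CubeFilling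

variable {V : Type} {G : SimpleGraph V}

theorem continuous_charMap (f : ParamCube G) : Continuous (charMap f) :=
  continuous_quot_mk.comp continuous_sigmaMk

theorem isOpen_iff {U : Set (CubeFilling G)} :
    IsOpen U ↔ ∀ f : ParamCube G, IsOpen (charMap f ⁻¹' U) :=
  isOpen_coinduced.trans isOpen_sigma_iff

/-- The extension of a function on the vertices to the whole complex. -/
noncomputable def extend (g : V → ℝ) : CubeFilling G → ℝ :=
  Quot.lift (fun p => interp (fun ε => g (p.1.2 ε)) (p.2 : Fin p.1.1 → ℝ)) (by
    rintro p q ⟨ι, s, c, h1, h2⟩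
    simp only [h1]
    rw [h2]
    exact interp_faceMap ι s c (fun ε => g (q.1.2 ε)) _)

theorem extend_charMap (g : V → ℝ) (f : ParamCube G) (x : SolidCube f.1) :
    extend g (charMap f x) = interp (fun ε => g (f.2 ε)) x := rfl

theorem continuous_extend (g : V → ℝ) : Continuous (extend g : CubeFilling G → ℝ) :=
  continuous_quot_lift _ (continuous_sigma fun f =>
    (continuous_interp fun ε => g (f.2 ε)).comp continuous_subtype_val)

end CubeFilling

/-! ### Points of the complex -/

theorem mem_closedBall_pi_iff {k : ℕ} {x : Fin k → ℝ} :
    x ∈ closedBall (0 : Fin k → ℝ) 1 ↔ ∀ a, -1 ≤ x a ∧ x a ≤ 1 := by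
  simp [pi_norm_le_iff_of_nonneg, abs_le]

/-- The nearest point of the solid cube. -/
noncomputable def clamp {k : ℕ} (x : Fin k → ℝ) : SolidCube k :=
  ⟨fun a => max (-1) (min 1 (x a)), mem_closedBall_pi_iff.2 fun a => by simp⟩

theorem continuous_clamp {k : ℕ} : Continuous (clamp : (Fin k → ℝ) → SolidCube k) :=
  Continuous.subtype_mk (by fun_prop) _

theorem coe_clamp {k : ℕ} {x : Fin k → ℝ} (hx : ∀ a, -1 ≤ x a ∧ x a ≤ 1) :
    (clamp x : Fin k → ℝ) = x :=
  funext fun a => by simp [clamp, hx a]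

/-- The position in `ℝⁿ` of the point `x` of the cube with lowest vertex `0` and directions `ι`. -/
noncomputable def cellVec {k n : ℕ} (ι : Fin k ↪ Fin n) (x : Fin k → ℝ) : Fin n → ℝ :=
  Function.extend ι (fun a => (1 + x a) / 2) 0

theorem cellVec_apply {k n : ℕ} (ι : Fin k ↪ Fin n) (x : Fin k → ℝ) (a : Fin k) :
    cellVec ι x (ι a) = (1 + x a) / 2 := ι.injective.extend_apply _ _ _

theorem cellVec_of_notMem {k n : ℕ} (ι : Fin k ↪ Fin n) (x : Fin k → ℝ) {i : Fin n}
    (hi : i ∉ range ι) : cellVec ι x i = 0 :=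
  Function.extend_apply' _ _ _ fun ⟨a, ha⟩ => hi ⟨a, ha⟩

theorem cellVec_mem_Icc {k n : ℕ} (ι : Fin k ↪ Fin n) {x : Fin k → ℝ}
    (hx : ∀ a, -1 ≤ x a ∧ x a ≤ 1) (i : Fin n) : 0 ≤ cellVec ι x i ∧ cellVec ι x i ≤ 1 := by
  by_cases hi : i ∈ range ι
  · obtain ⟨a, rfl⟩ := hi
    rw [cellVec_apply]
    constructor <;> linarith [hx a]
  · rw [cellVec_of_notMem ι x hi]
    simp

theorem continuous_cellVec {k n : ℕ} (ι : Fin k ↪ Fin n) : Continuous (cellVec ι) := by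
  refine continuous_pi fun i => ?_
  by_cases hi : i ∈ range ι
  · obtain ⟨a, rfl⟩ := hi
    simp only [cellVec_apply]
    fun_prop
  · simp only [cellVec_of_notMem ι _ hi]
    fun_prop

/-! ### Orthants, normal forms and the Hausdorff property -/

namespace HoughtonComplex

open HoughtonMonoid CubeFilling

variable {n : ℕ}

/-- The point at position `w ∈ [0, 1]ⁿ` in the `n`-cube with lowest vertex `β`. -/
noncomputable def corner (β : HoughtonMonoid n) (w : Fin n → ℝ) : HoughtonComplex n :=
  charMap ⟨n, cubeAt β (Function.Embedding.refl _)⟩ (clamp fun i => 2 * w i - 1)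

/-- The point at position `v ∈ [0, ∞)ⁿ` in the orthant with lowest vertex `α`. Negative
coordinates of `v` are replaced by `0`. -/
noncomputable def pt (α : HoughtonMonoid n) (v : Fin n → ℝ) : HoughtonComplex n :=
  corner (tr (fun i => ⌊v i⌋₊) α) (fun i => max (v i) 0 - ⌊v i⌋₊)

theorem continuous_corner (β : HoughtonMonoid n) : Continuous (corner β) :=
  (continuous_charMap _).comp (continuous_clamp.comp (by fun_prop))

/-- A single gluing relation: `κ` gives the free directions of a face of the `n`-cube at `β`, the
signs `c` fix the other coordinates, and `A` leads from `β` to the lowest vertex of the face. -/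
theorem charMap_cubeAt_face {j : ℕ} (κ : Fin j ↪ Fin n) (c : Fin n → ℤˣ)
    (β : HoughtonMonoid n) (A : Fin n → ℕ) (z : SolidCube j) (w : Fin n → ℝ)
    (hA : ∀ a, A (κ a) = 0) (hA' : ∀ i ∉ range κ, A i = if c i = 1 then 1 else 0)
    (hw : ∀ a, 2 * w (κ a) - 1 = (z : Fin j → ℝ) a)
    (hw' : ∀ i ∉ range κ, 2 * w i - 1 = ((c i : ℤ) : ℝ)) :
    charMap ⟨j, cubeAt (tr A β) κ⟩ z = corner β w := by
  refine Quot.sound ⟨κ, 1, c, fun ε => ?_, ?_⟩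
  · change tr _ (tr A β) = tr _ β
    rw [tr_tr]
    congr 1
    funext i
    rw [Pi.add_apply]
    have hrefl := cubeVec_apply (Function.Embedding.refl (Fin n)) (faceMap κ 1 c ε) i
    rw [Function.Embedding.refl_apply] at hrefl
    rw [hrefl]
    by_cases hi : i ∈ range κ
    · obtain ⟨a, rfl⟩ := hi
      rw [hA, cubeVec_apply, faceMap_apply]
      simp
    · rw [hA' i hi, cubeVec_of_notMem κ ε hi, faceMap_of_notMem _ _ _ _ hi]
      simp
  · have h : ∀ i, (2 * w i - 1 = faceMap κ (fun a => (((1 : Fin j → ℤˣ) a : ℤ) : ℝ))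
        (fun b => ((c b : ℤ) : ℝ)) (z : Fin j → ℝ) i) := by
      intro i
      by_cases hi : i ∈ range κ
      · obtain ⟨a, rfl⟩ := hi
        rw [hw, faceMap_apply]
        simp
      · rw [hw' i hi, faceMap_of_notMem _ _ _ _ hi]
    refine (coe_clamp fun i => ?_).trans (funext h)
    by_cases hi : i ∈ range κ
    · obtain ⟨a, rfl⟩ := hi
      rw [hw]
      exact mem_closedBall_pi_iff.1 z.2 a
    · rw [hw' i hi]
      rcases cast_units_eq_or (c i) with h | h <;> rw [h] <;> norm_num

/-- Where `w i = 1` the floor in `pt` passes to the next cube. The two cubes share the face on which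
these coordinates are constant: it is an upper face of the first cube (`h1`) and a lower face of the
second (`h2`). -/
theorem corner_eq_pt (β : HoughtonMonoid n) {w : Fin n → ℝ} (hw : ∀ i, 0 ≤ w i ∧ w i ≤ 1) :
    corner β w = pt β w := by
  classical
  set S : Finset (Fin n) := Finset.univ.filter fun i => w i ≠ 1
  set κ : Fin S.card ↪ Fin n := (S.orderEmbOfFin rfl).toEmbedding
  have hκ : range κ = {i | w i ≠ 1} := by
    refine (S.range_orderEmbOfFin rfl).trans ?_
    simp [S]
  have hfl : ∀ i, ⌊w i⌋₊ = if w i = 1 then 1 else 0 := by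
    intro i
    split_ifs with h
    · simp [h]
    · exact Nat.floor_eq_zero.2 (lt_of_le_of_ne (hw i).2 h)
  have hz : (fun a => 2 * w (κ a) - 1) ∈ closedBall (0 : Fin S.card → ℝ) 1 :=
    mem_closedBall_pi_iff.2 fun a => by constructor <;> linarith [hw (κ a)]
  have hκ1 : ∀ a, w (κ a) ≠ 1 := fun a => by
    have : κ a ∈ range κ := mem_range_self a
    rwa [hκ] at this
  have hκ2 : ∀ i ∉ range κ, w i = 1 := fun i hi => by simpa [hκ] using hi
  have h1 := charMap_cubeAt_face κ (fun i => if w i = 1 then 1 else -1) β (fun i => ⌊w i⌋₊)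
    ⟨_, hz⟩ w (fun a => by simp [hfl, hκ1]) (fun i hi => by simp [hκ2 i hi])
    (fun a => rfl) (fun i hi => by simp [hκ2 i hi]; norm_num)
  have h2 := charMap_cubeAt_face κ (fun i => -1) (tr (fun i => ⌊w i⌋₊) β) 0
    ⟨_, hz⟩ (fun i => max (w i) 0 - ⌊w i⌋₊) (fun a => rfl) (fun i hi => by simp)
    (fun a => by simp [hfl, hκ1, (hw _).1]) (fun i hi => by simp [hκ2 i hi])
  rw [tr_zero] at h2
  exact h1.symm.trans h2

theorem charMap_cubeAt {k : ℕ} (β : HoughtonMonoid n) (ι : Fin k ↪ Fin n) (x : SolidCube k) :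
    charMap ⟨k, cubeAt β ι⟩ x = pt β (cellVec ι x) := by
  have h := charMap_cubeAt_face ι (fun i => -1) β 0 x (cellVec ι x)
    (fun a => rfl) (fun i hi => by simp) (fun a => by rw [cellVec_apply]; ring)
    (fun i hi => by simp [cellVec_of_notMem ι _ hi])
  rw [tr_zero] at h
  rw [h, corner_eq_pt β (cellVec_mem_Icc ι (mem_closedBall_pi_iff.1 x.2))]

/-- Sign changes of the coordinates are among the gluings, so `exists_eq_cubeAt` brings every
parametrized cube into an orthant. -/
theorem exists_charMap_eq {f : ParamCube (cayleyGraph n)} :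
    ∃ (β : HoughtonMonoid n) (ι : Fin f.1 ↪ Fin n) (s : Fin f.1 → ℤˣ),
      (∀ ε, f.2 ε = cubeAt β ι (s * ε)) ∧
      ∀ x, charMap f x = pt β (cellVec ι (signVec s * x)) := by
  obtain ⟨β, ι, s, h⟩ := exists_eq_cubeAt f.2
  refine ⟨β, ι, s, h, fun x => ?_⟩
  have hx : signVec s * (x : Fin f.1 → ℝ) ∈ closedBall (0 : Fin f.1 → ℝ) 1 := by
    refine mem_closedBall_pi_iff.2 fun a => ?_
    have := mem_closedBall_pi_iff.1 x.2 a
    simp only [Pi.mul_apply, signVec]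
    rcases cast_units_eq_or (s a) with h | h <;> rw [h] <;> constructor <;> linarith
  rw [← charMap_cubeAt β ι ⟨_, hx⟩]
  have hr : ∀ {R : Type} [Mul R] (s c x : Fin f.1 → R),
      faceMap (Function.Embedding.refl _) s c x = s * x := fun s c x => funext fun a =>
    faceMap_apply (Function.Embedding.refl _) s c x a
  refine Quot.sound ⟨Function.Embedding.refl _, s, 1, fun ε => ?_, ?_⟩
  · rw [hr]
    exact h ε
  · exact (hr _ _ _).symm

theorem pt_eq_pt {α β : HoughtonMonoid n} {v w : Fin n → ℝ}
    (h : tr (fun i => ⌊v i⌋₊) α = tr (fun i => ⌊w i⌋₊) β)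
    (h' : ∀ i, max (v i) 0 - ⌊v i⌋₊ = max (w i) 0 - ⌊w i⌋₊) : pt α v = pt β w := by
  rw [pt, pt, h, funext h']

theorem pt_max (α : HoughtonMonoid n) (v : Fin n → ℝ) : pt α (fun i => max (v i) 0) = pt α v := by
  have h : ∀ x : ℝ, ⌊max x 0⌋₊ = ⌊x⌋₊ := fun x => by
    rcases le_total x 0 with h | h
    · simp [h, Nat.floor_of_nonpos]
    · simp [h]
  exact pt_eq_pt (by simp only [h]) fun i => by simp [h]

theorem pt_add (α : HoughtonMonoid n) (a : Fin n → ℕ) {v : Fin n → ℝ} (hv : ∀ i, 0 ≤ v i) :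
    pt α (fun i => v i + a i) = pt (tr a α) v := by
  refine pt_eq_pt ?_ fun i => ?_
  · rw [tr_tr]
    congr 1
    funext i
    simp [Nat.floor_add_natCast (hv i)]
  · rw [Nat.floor_add_natCast (hv i), max_eq_left (hv i),
      max_eq_left (add_nonneg (hv i) (Nat.cast_nonneg _))]
    push_cast
    ring

theorem locallyFinite_unitCubes : LocallyFinite fun a : Fin n → ℕ =>
    {v : Fin n → ℝ | ∀ i, (a i : ℝ) ≤ v i ∧ v i ≤ a i + 1} := by
  intro v
  refine ⟨{w | ∀ i, w i < v i + 1}, ?_, ?_⟩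
  · refine IsOpen.mem_nhds ?_ fun i => by linarith
    simp only [ofPred_forall]
    exact isOpen_iInter_of_finite fun i => isOpen_lt (by fun_prop) (by fun_prop)
  · refine (Set.finite_Iic fun i => ⌊v i + 1⌋₊).subset ?_
    rintro a ⟨w, hw, hw'⟩ i
    exact Nat.le_floor ((hw i).1.trans (hw' i).le)

/-- The floors jump, but on each closed unit cube `corner_eq_pt` rewrites `pt α` as a single
characteristic map, and these unit cubes form a locally finite closed cover. -/
theorem continuous_pt (α : HoughtonMonoid n) : Continuous (pt α) := by
  have hc : Continuous fun (v : Fin n → ℝ) i => max (v i) 0 := by fun_prop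
  refine (locallyFinite_unitCubes.preimage_continuous hc).continuous ?_ ?_ ?_
  · refine eq_univ_of_forall fun v => mem_iUnion.2 ⟨fun i => ⌊max (v i) 0⌋₊, fun i => ?_⟩
    exact ⟨Nat.floor_le (le_max_right _ _), (Nat.lt_floor_add_one _).le⟩
  · intro a
    refine IsClosed.preimage hc ?_
    simp only [ofPred_forall]
    refine isClosed_iInter fun i => ?_
    rw [ofPred_and]
    exact (isClosed_le (by fun_prop) (by fun_prop)).inter (isClosed_le (by fun_prop) (by fun_prop))
  · intro a
    have : Continuous fun v : Fin n → ℝ => corner (tr a α) fun i => max (v i) 0 - a i :=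
      (continuous_corner _).comp (by fun_prop)
    refine this.continuousOn.congr fun v hv => ?_
    have hv' : ∀ i, (a i : ℝ) ≤ max (v i) 0 ∧ max (v i) 0 ≤ a i + 1 := hv
    change pt α v = corner _ _
    rw [corner_eq_pt _ fun i => ⟨by linarith [hv' i], by linarith [hv' i]⟩,
      ← pt_add α a fun i => by linarith [hv' i], ← pt_max]
    simp

theorem sub_floor_mem_Ico (x : ℝ) : 0 ≤ max x 0 - ⌊x⌋₊ ∧ max x 0 - ⌊x⌋₊ < 1 := by
  rcases le_total x 0 with hi | hi
  · simp [hi, Nat.floor_of_nonpos]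
  · rw [max_eq_left hi]
    exact ⟨sub_nonneg.2 (Nat.floor_le hi), by linarith [Nat.lt_floor_add_one x]⟩

/-- Every point has a normal form. -/
theorem exists_pt_eq (z : HoughtonComplex n) :
    ∃ (α : HoughtonMonoid n) (v : Fin n → ℝ), (∀ i, 0 ≤ v i ∧ v i < 1) ∧ pt α v = z := by
  obtain ⟨f, x⟩ := z
  obtain ⟨β, ι, s, -, h⟩ := exists_charMap_eq (f := f)
  set w := cellVec ι (signVec s * x) with hw
  have h0 := fun i => sub_floor_mem_Ico (w i)
  refine ⟨tr (fun i => ⌊w i⌋₊) β, _, h0, ?_⟩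
  refine Eq.trans ?_ (h x).symm
  rw [← corner_eq_pt _ fun i => ⟨(h0 i).1, (h0 i).2.le⟩]
  rfl

theorem extend_pt (g : HoughtonMonoid n → ℝ) (α : HoughtonMonoid n) {v : Fin n → ℝ}
    (hv : ∀ i, 0 ≤ v i ∧ v i ≤ 1) :
    CubeFilling.extend g (pt α v) =
      interp (fun ε => g (cubeAt α (Function.Embedding.refl _) ε)) fun i => 2 * v i - 1 := by
  rw [← corner_eq_pt α hv, corner, extend_charMap,
    coe_clamp fun i => ⟨by linarith [hv i], by linarith [hv i]⟩]

/-- The position of a point in `ℝⁿ`. -/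
noncomputable def height (z : HoughtonComplex n) (i : Fin n) : ℝ :=
  CubeFilling.extend (fun γ : HoughtonMonoid n => (γ.shift i : ℝ)) z

theorem continuous_height : Continuous (height : HoughtonComplex n → Fin n → ℝ) :=
  continuous_pi fun _ => continuous_extend _

theorem cubeVec_refl (ε : Fin n → ℤˣ) (i : Fin n) :
    cubeVec (Function.Embedding.refl _) ε i = if ε i = 1 then 1 else 0 :=
  cubeVec_apply (Function.Embedding.refl _) ε i

theorem height_pt (α : HoughtonMonoid n) (v : Fin n → ℝ) (i : Fin n) :
    height (pt α v) i = α.shift i + max (v i) 0 := by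
  have key : ∀ (β : HoughtonMonoid n) {w : Fin n → ℝ}, (∀ i, 0 ≤ w i ∧ w i ≤ 1) →
      height (pt β w) i = β.shift i + w i := by
    intro β w hw
    rw [height, extend_pt _ _ hw, interp_eq_of_isMultiAffine
      (F := fun x => β.shift i + (1 + x i) / 2)]
    · ring
    · intro x a u
      by_cases h : i = a
      · subst h
        simp only [Function.update_self]
        ring
      · simp only [Function.update_of_ne h]
        ring
    · intro ε
      rw [cubeAt_apply, shift_tr, cubeVec_refl]
      rcases Int.units_eq_one_or (ε i) with h | h <;> simp [signVec, h]
  have h0 := fun i => And.imp_right le_of_lt (sub_floor_mem_Ico (v i))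
  rw [pt, corner_eq_pt _ h0, key _ h0, shift_tr]
  push_cast
  ring

/-- The points of the open star of the vertex `α` are separated from those of the open star of a
vertex with the same translation vector. -/
theorem extend_indicator_ne {α β : HoughtonMonoid n} (hne : α ≠ β) (hs : α.shift = β.shift)
    {v : Fin n → ℝ} (hv : ∀ i, 0 ≤ v i ∧ v i < 1) :
    CubeFilling.extend (indicator {α} 1) (pt α v) ≠
      CubeFilling.extend (indicator {α} 1) (pt β v) := by
  have hv' : ∀ i, 0 ≤ v i ∧ v i ≤ 1 := fun i => ⟨(hv i).1, (hv i).2.le⟩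
  -- The vertex `α` is not in the cube above `β`: a translate of `β` with the same shift is `β`
  -- itself. So the indicator of `α` vanishes on that cube, while it is positive on the half-open
  -- cube above `α`.
  have key : ∀ ε : Fin n → ℤˣ,
      cubeAt β (Function.Embedding.refl (Fin n)) ε ≠ α := by
    intro ε h
    rw [cubeAt_apply] at h
    have : cubeVec (Function.Embedding.refl (Fin n)) ε = 0 := by
      funext i
      have := congrArg (fun γ => HoughtonMonoid.shift γ i) h
      simp only [shift_tr, hs] at this
      simp only [Pi.zero_apply]
      omega
    rw [this, tr_zero] at h
    exact hne h.symm
  rw [extend_pt _ _ hv', extend_pt _ _ hv']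
  have h2 : interp (fun ε => indicator {α} (1 : HoughtonMonoid n → ℝ)
      (cubeAt β (Function.Embedding.refl _) ε)) (fun i => 2 * v i - 1) = 0 :=
    Finset.sum_eq_zero fun ε _ => by simp [-cubeAt_apply, key]
  rw [h2]
  refine ne_of_gt ?_
  rw [interp, Finset.sum_eq_single (-1)]
  · have : cubeAt α (Function.Embedding.refl (Fin n)) (-1) = α := by simp [cubeVec_neg_one]
    rw [this]
    simp only [mem_singleton_iff, indicator_of_mem, Pi.one_apply, mul_one, vertexWeight]
    refine Finset.prod_pos fun i _ => ?_
    simp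
    linarith [hv i]
  · intro ε _ hε
    have : cubeAt α (Function.Embedding.refl (Fin n)) ε ≠ α := by
      intro h
      have h := tr_eq_self h
      rw [← cubeVec_neg_one (Function.Embedding.refl (Fin n))] at h
      exact hε (cubeVec_injective _ h)
    rw [indicator_of_notMem (by exact this), mul_zero]
  · simp

/-- In normal form the shift is the integer part of the height and `v` is its fractional part. -/
theorem eq_of_height_eq {α β : HoughtonMonoid n} {v w : Fin n → ℝ} (hv : ∀ i, 0 ≤ v i ∧ v i < 1)
    (hw : ∀ i, 0 ≤ w i ∧ w i < 1) (h : height (pt α v) = height (pt β w)) :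
    α.shift = β.shift ∧ v = w := by
  have hh : ∀ i, (α.shift i : ℝ) + v i = β.shift i + w i := by
    intro i
    have := congrFun h i
    rwa [height_pt, height_pt, max_eq_left (hv i).1, max_eq_left (hw i).1] at this
  have hs : α.shift = β.shift := by
    funext i
    have h1 : ((α.shift i - β.shift i : ℤ) : ℝ) < 1 := by push_cast; linarith [hh i, hv i, hw i]
    have h2 : ((β.shift i - α.shift i : ℤ) : ℝ) < 1 := by push_cast; linarith [hh i, hv i, hw i]
    norm_cast at h1 h2
    omega
  exact ⟨hs, funext fun i => by simpa [hs] using hh i⟩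

/-- Normal forms are unique. -/
theorem pt_injective {α β : HoughtonMonoid n} {v w : Fin n → ℝ} (hv : ∀ i, 0 ≤ v i ∧ v i < 1)
    (hw : ∀ i, 0 ≤ w i ∧ w i < 1) (h : pt α v = pt β w) : α = β ∧ v = w := by
  obtain ⟨hs, rfl⟩ := eq_of_height_eq hv hw (congrArg height h)
  refine ⟨?_, rfl⟩
  by_contra hne
  exact extend_indicator_ne hne hs hv (by rw [h])

/-- Points of different heights are separated by `height`. Points of equal height differ only in the
lowest vertex and are separated by the extended indicator of one of the two vertices. -/
instance : T2Space (HoughtonComplex n) := by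
  refine ⟨fun y z hne => ?_⟩
  by_cases hyz : height y = height z
  · obtain ⟨α, v, hv, rfl⟩ := exists_pt_eq y
    obtain ⟨β, w, hw, rfl⟩ := exists_pt_eq z
    obtain ⟨hs, rfl⟩ := eq_of_height_eq hv hw hyz
    have hαβ : α ≠ β := by
      rintro rfl
      exact hne rfl
    exact separated_by_continuous (continuous_extend (indicator {α} 1))
      (extend_indicator_ne hαβ hs hv)
  · exact separated_by_continuous continuous_height hyz

end HoughtonComplex

/-! ### The cubical structure -/

theorem mem_ball_pi_iff {k : ℕ} {x : Fin k → ℝ} :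
    x ∈ ball (0 : Fin k → ℝ) 1 ↔ ∀ a, -1 < x a ∧ x a < 1 := by
  simp [pi_norm_lt_iff, abs_lt]

theorem exists_eq_of_mem_sphere {k : ℕ} {x : Fin k → ℝ} (hx : x ∈ sphere (0 : Fin k → ℝ) 1) :
    ∃ a, x a = 1 ∨ x a = -1 := by
  by_contra! h
  have h1 := mem_closedBall_pi_iff.1 (sphere_subset_closedBall hx)
  have : x ∈ ball (0 : Fin k → ℝ) 1 := mem_ball_pi_iff.2 fun a =>
    ⟨lt_of_le_of_ne (h1 a).1 (h a).2.symm, lt_of_le_of_ne (h1 a).2 (h a).1⟩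
  exact (sphere_disjoint_ball.le_bot ⟨hx, this⟩ : x ∈ (∅ : Set _))

section cellVec

variable {k n : ℕ}

theorem cellVec_mem_Ico (ι : Fin k ↪ Fin n) {x : Fin k → ℝ} (hx : x ∈ ball (0 : Fin k → ℝ) 1)
    (i : Fin n) : 0 ≤ cellVec ι x i ∧ cellVec ι x i < 1 := by
  rw [mem_ball_pi_iff] at hx
  by_cases hi : i ∈ range ι
  · obtain ⟨a, rfl⟩ := hi
    rw [cellVec_apply]
    constructor <;> linarith [hx a]
  · rw [cellVec_of_notMem ι x hi]
    simp

theorem range_eq_cellVec_ne_zero (ι : Fin k ↪ Fin n) {x : Fin k → ℝ}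
    (hx : x ∈ ball (0 : Fin k → ℝ) 1) : range ι = {i | cellVec ι x i ≠ 0} := by
  ext i
  by_cases hi : i ∈ range ι
  · refine iff_of_true hi ?_
    obtain ⟨a, rfl⟩ := hi
    rw [mem_ofPred_eq, cellVec_apply]
    linarith [mem_ball_pi_iff.1 hx a]
  · exact iff_of_false hi (by simp [cellVec_of_notMem ι x hi])

theorem exists_cellVec_eq {v : Fin n → ℝ} (hv : ∀ i, 0 ≤ v i ∧ v i < 1) :
    ∃ (k : ℕ) (ι : Fin k ↪o Fin n), ∃ x ∈ ball (0 : Fin k → ℝ) 1, cellVec ι.toEmbedding x = v := by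
  classical
  set S : Finset (Fin n) := Finset.univ.filter fun i => v i ≠ 0
  set κ := S.orderEmbOfFin rfl
  have hκ : range κ = {i | v i ≠ 0} := (S.range_orderEmbOfFin rfl).trans (by simp [S])
  refine ⟨S.card, κ, fun a => 2 * v (κ a) - 1, mem_ball_pi_iff.2 fun a => ?_, funext fun i => ?_⟩
  · have h : v (κ a) ≠ 0 := by
      have : κ a ∈ range κ := mem_range_self a
      rwa [hκ] at this
    have := lt_of_le_of_ne (hv (κ a)).1 h.symm
    constructor <;> linarith [hv (κ a)]
  · by_cases hi : i ∈ range κ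
    · obtain ⟨a, rfl⟩ := hi
      refine (cellVec_apply κ.toEmbedding _ a).trans ?_
      ring
    · rw [cellVec_of_notMem κ.toEmbedding _ hi]
      symm
      simpa [hκ] using hi

end cellVec

namespace HoughtonComplex

open HoughtonMonoid CubeFilling

variable {n : ℕ}

theorem pt_floor (α : HoughtonMonoid n) (v : Fin n → ℝ) :
    pt α v = pt (tr (fun i => ⌊v i⌋₊) α) (fun i => max (v i) 0 - ⌊v i⌋₊) :=
  corner_eq_pt _ fun i => (sub_floor_mem_Ico (v i)).imp_right le_of_lt

/-- A `k`-cell is given by its lowest vertex and the set of its directions. -/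
abbrev Cell (n k : ℕ) : Type := HoughtonMonoid n × (Fin k ↪o Fin n)

/-- The characteristic map of a cell. -/
noncomputable def cellMap {k : ℕ} (c : Cell n k) (x : Fin k → ℝ) : HoughtonComplex n :=
  pt c.1 (cellVec c.2.toEmbedding x)

theorem continuous_cellMap {k : ℕ} (c : Cell n k) : Continuous (cellMap c) :=
  (continuous_pt _).comp (continuous_cellVec _)

/-- The inverse of the characteristic map. -/
noncomputable def cellCoord {k : ℕ} (c : Cell n k) (z : HoughtonComplex n) (a : Fin k) : ℝ :=
  2 * (height z (c.2 a) - c.1.shift (c.2 a)) - 1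

theorem continuous_cellCoord {k : ℕ} (c : Cell n k) : Continuous (cellCoord c) :=
  continuous_pi fun a => ((((continuous_apply (c.2 a)).comp continuous_height).sub
    continuous_const).const_mul 2).sub continuous_const

theorem cellCoord_cellMap {k : ℕ} (c : Cell n k) {x : Fin k → ℝ}
    (hx : x ∈ closedBall (0 : Fin k → ℝ) 1) : cellCoord c (cellMap c x) = x := by
  funext a
  have h : cellVec c.2.toEmbedding x (c.2 a) = _ := cellVec_apply c.2.toEmbedding x a
  rw [mem_closedBall_pi_iff] at hx
  rw [cellCoord, cellMap, height_pt, h, max_eq_left (by linarith [hx a])]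
  ring

theorem exists_cellMap_eq {α : HoughtonMonoid n} {v : Fin n → ℝ} (hv : ∀ i, 0 ≤ v i ∧ v i < 1) :
    ∃ (k : ℕ) (ι : Fin k ↪o Fin n), ∃ x ∈ ball (0 : Fin k → ℝ) 1,
      range ι = {i | v i ≠ 0} ∧ cellMap (α, ι) x = pt α v := by
  obtain ⟨k, ι, x, hx, rfl⟩ := exists_cellVec_eq hv
  exact ⟨k, ι, x, hx, range_eq_cellVec_ne_zero ι.toEmbedding hx, rfl⟩

theorem pt_mem_cellMap_image {α : HoughtonMonoid n} {v : Fin n → ℝ}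
    (hv : ∀ i, 0 ≤ v i ∧ v i ≤ 1) :
    pt α v ∈ cellMap (α, RelEmbedding.refl _) '' closedBall (0 : Fin n → ℝ) 1 := by
  refine ⟨fun i => 2 * v i - 1, mem_closedBall_pi_iff.2 fun i => ?_, ?_⟩
  · constructor <;> linarith [hv i]
  · rw [cellMap]
    congr 1
    funext i
    refine (cellVec_apply (RelEmbedding.refl _ : Fin n ↪o Fin n).toEmbedding _ i).trans ?_
    ring

/-- Interior points of a cell are already in normal form, and the directions of the cell are the
nonzero coordinates. -/
theorem cell_eq_of_cellMap_eq {k l : ℕ} {c : Cell n k} {d : Cell n l} {x : Fin k → ℝ}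
    {y : Fin l → ℝ} (hx : x ∈ ball (0 : Fin k → ℝ) 1) (hy : y ∈ ball (0 : Fin l → ℝ) 1)
    (h : cellMap c x = cellMap d y) : (⟨k, c⟩ : Σ k, Cell n k) = ⟨l, d⟩ := by
  obtain ⟨α, ι⟩ := c
  obtain ⟨β, κ⟩ := d
  obtain ⟨rfl : α = β, hv⟩ := pt_injective (cellVec_mem_Ico _ hx) (cellVec_mem_Ico _ hy) h
  have hr : range ι = range κ := by
    rw [show range ι = _ from range_eq_cellVec_ne_zero ι.toEmbedding hx,
      show range κ = _ from range_eq_cellVec_ne_zero κ.toEmbedding hy]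
    ext i
    exact not_congr (by rw [show cellVec ι.toEmbedding x i = _ from congrFun hv i])
  obtain rfl : k = l := by
    have := congrArg Set.ncard hr
    rwa [← image_univ, ← image_univ, ncard_image_of_injective _ ι.injective,
      ncard_image_of_injective _ κ.injective, ncard_univ, ncard_univ, Nat.card_fin,
      Nat.card_fin] at this
  rw [OrderEmbedding.range_inj.1 hr]

/-- On the boundary some direction has position `0` or `1`, which becomes `0` in the normal form, so
the dimension drops. The lowest vertex moves only by a 0/1 vector, which leaves finitely many cells.
-/
theorem cellMap_mapsTo {k : ℕ} (c : Cell n k) : ∃ I : Π m, Finset (Cell n m),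
    MapsTo (cellMap c) (sphere 0 1) (⋃ (m < k) (j ∈ I m), cellMap j '' closedBall 0 1) := by
  classical
  obtain ⟨α, ι⟩ := c
  have hfin : ∀ m, (range fun p : Finset (Fin n) × (Fin m ↪o Fin n) =>
      ((tr (fun i => if i ∈ p.1 then 1 else 0) α, p.2) : Cell n m)).Finite := fun m =>
    finite_range _
  refine ⟨fun m => (hfin m).toFinset, fun x hx => ?_⟩
  have hxc := mem_closedBall_pi_iff.1 (sphere_subset_closedBall hx)
  set w := cellVec ι.toEmbedding x with hw_def
  have hw : ∀ i, 0 ≤ w i ∧ w i ≤ 1 := cellVec_mem_Icc _ hxc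
  obtain ⟨l, κ, y, hy, hr, h⟩ := exists_cellMap_eq (α := tr (fun i => ⌊w i⌋₊) α)
    fun i => sub_floor_mem_Ico (w i)
  rw [← pt_floor] at h
  simp only [mem_iUnion]
  refine ⟨l, ?_, _, ?_, y, ball_subset_closedBall hy, h⟩
  · obtain ⟨a, ha⟩ := exists_eq_of_mem_sphere hx
    have hlt : range κ ⊂ range ι := by
      rw [hr, ssubset_iff_of_subset]
      · refine ⟨ι a, mem_range_self a, ?_⟩
        have : w (ι a) = (1 + x a) / 2 := cellVec_apply ι.toEmbedding x a
        rcases ha with ha | ha <;> simp [this, ha]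
      · intro i hi
        by_contra hi'
        have : w i = 0 := cellVec_of_notMem ι.toEmbedding x hi'
        simp [this] at hi
    have := ncard_lt_ncard hlt
    rwa [← image_univ, ← image_univ, ncard_image_of_injective _ ι.injective,
      ncard_image_of_injective _ κ.injective, ncard_univ, ncard_univ, Nat.card_fin,
      Nat.card_fin] at this
  · rw [Set.Finite.mem_toFinset]
    refine ⟨(Finset.univ.filter fun i => w i = 1, κ), ?_⟩
    refine Prod.ext ?_ rfl
    dsimp only
    congr 1
    funext i
    simp only [Finset.mem_filter, Finset.mem_univ, true_and]
    split_ifs with h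
    · simp [h]
    · exact (Nat.floor_eq_zero.2 (lt_of_le_of_ne (hw i).2 h)).symm

theorem cellMap_insertNth {k : ℕ} (α : HoughtonMonoid n) (ι : Fin (k + 1) ↪o Fin n)
    (a : Fin (k + 1)) (σ : ℤˣ) (x : Fin k → ℝ) (hx : x ∈ closedBall (0 : Fin k → ℝ) 1) :
    cellMap (α, ι) (Fin.insertNth (α := fun _ => ℝ) a ((σ : ℤ) : ℝ) x) =
      cellMap (tr (Pi.single (ι a) (if σ = 1 then 1 else 0)) α,
        (Fin.succAboveOrderEmb a).trans ι) x := by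
  rw [cellMap, cellMap, ← pt_add]
  · congr 1
    funext i
    set κ := (Fin.succAboveOrderEmb a).trans ι with hκ
    by_cases hi : i ∈ range ι
    · obtain ⟨b, rfl⟩ := hi
      refine (cellVec_apply ι.toEmbedding _ b).trans ?_
      rcases Fin.eq_self_or_eq_succAbove a b with rfl | ⟨b, rfl⟩
      · have : ι b ∉ range κ := by
          rintro ⟨c, hc⟩
          exact Fin.succAbove_ne b c (ι.injective hc)
        rw [cellVec_of_notMem κ.toEmbedding _ this, Fin.insertNth_apply_same]
        rcases Int.units_eq_one_or σ with rfl | rfl <;> simp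
      · have : cellVec κ.toEmbedding x (ι (a.succAbove b)) = (1 + x b) / 2 :=
          cellVec_apply κ.toEmbedding x b
        rw [this, Fin.insertNth_apply_succAbove]
        simp [Fin.succAbove_ne]
    · have h1 : i ∉ range κ := by
        rintro ⟨c, rfl⟩
        exact hi ⟨_, rfl⟩
      have h2 : i ≠ ι a := fun h => hi ⟨a, h.symm⟩
      rw [cellVec_of_notMem ι.toEmbedding _ hi, cellVec_of_notMem κ.toEmbedding _ h1]
      simp [h2]
  · exact fun i => (cellVec_mem_Icc _ (mem_closedBall_pi_iff.1 hx) i).1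

/-- Cells of dimension `n` suffice because every cube lies in an `n`-cube with the same lowest
vertex. -/
theorem isClosed_of_inter_cellMap {A : Set (HoughtonComplex n)}
    (hA : ∀ c : Cell n n, IsClosed (A ∩ cellMap c '' closedBall 0 1)) : IsClosed A := by
  rw [← isOpen_compl_iff, isOpen_iff]
  intro f
  obtain ⟨β, ι, s, -, h⟩ := exists_charMap_eq (f := f)
  have : charMap f ⁻¹' Aᶜ = (charMap f ⁻¹' (A ∩
      cellMap (β, RelEmbedding.refl _) '' closedBall (0 : Fin n → ℝ) 1))ᶜ := by
    rw [preimage_compl, preimage_inter, inter_eq_left.2]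
    intro x _
    rw [mem_preimage, h]
    refine pt_mem_cellMap_image (cellVec_mem_Icc _ fun a => ?_)
    have := mem_closedBall_pi_iff.1 x.2 a
    simp only [Pi.mul_apply, signVec]
    rcases cast_units_eq_or (s a) with h | h <;> rw [h] <;> constructor <;> linarith
  rw [this]
  exact ((hA _).preimage (continuous_charMap f)).isOpen_compl

theorem iUnion_cellMap :
    ⋃ (k : ℕ) (c : Cell n k), cellMap c '' closedBall 0 1 = univ := by
  refine eq_univ_of_forall fun z => ?_
  obtain ⟨α, v, hv, rfl⟩ := exists_pt_eq z
  obtain ⟨k, ι, x, hx, -, h⟩ := exists_cellMap_eq (α := α) hv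
  exact mem_iUnion₂.2 ⟨k, (α, ι), x, ball_subset_closedBall hx, h⟩

/-- The cubical structure of `Xₙ`. -/
noncomputable def cubicalComplex (n : ℕ) : CubicalComplex (HoughtonComplex n) where
  cell := Cell n
  map k c :=
    { toFun := cellMap c
      invFun := cellCoord c
      source := ball 0 1
      target := cellMap c '' ball 0 1
      map_source' := fun x hx => mem_image_of_mem _ hx
      map_target' := by
        rintro _ ⟨x, hx, rfl⟩
        rwa [cellCoord_cellMap c (ball_subset_closedBall hx)]
      left_inv' := fun x hx => cellCoord_cellMap c (ball_subset_closedBall hx)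
      right_inv' := by
        rintro _ ⟨x, hx, rfl⟩
        rw [cellCoord_cellMap c (ball_subset_closedBall hx)] }
  source_eq _ _ := rfl
  continuousOn _ c := (continuous_cellMap c).continuousOn
  continuousOn_symm _ c := (continuous_cellCoord c).continuousOn
  pairwiseDisjoint' := by
    rintro ⟨k, c⟩ - ⟨l, d⟩ - hne
    refine Set.disjoint_left.2 ?_
    rintro _ ⟨x, hx, rfl⟩ ⟨y, hy, h⟩
    exact hne (cell_eq_of_cellMap_eq hx hy h.symm)
  mapsTo' _ c := cellMap_mapsTo c
  closed' _ _ hA := isClosed_of_inter_cellMap fun c => hA _ c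
  union' := iUnion_cellMap
  t2Space := inferInstance
  exists_facet := by
    rintro k ⟨α, ι⟩ a σ
    -- The identity isometry works because the directions of all cells are listed in increasing
    -- order.
    exact ⟨_, LinearIsometryEquiv.refl ℝ _, fun x hx => cellMap_insertNth α ι a σ x hx⟩
  isEmbedding_attach k c := by
    have h : Function.LeftInverse (fun z : cellMap c '' sphere 0 1 => (⟨cellCoord c z, by
        obtain ⟨_, x, hx, rfl⟩ := z
        rwa [cellCoord_cellMap c (sphere_subset_closedBall hx)]⟩ : sphere (0 : Fin k → ℝ) 1))
        (fun x => ⟨cellMap c x, mem_image_of_mem _ x.2⟩) := fun x =>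
      Subtype.ext (cellCoord_cellMap c (sphere_subset_closedBall x.2))
    exact IsEmbedding.subtypeVal.comp (h.isEmbedding
      (((continuous_cellCoord c).comp continuous_subtype_val).subtype_mk _)
      (((continuous_cellMap c).comp continuous_subtype_val).subtype_mk _))

/-! ### Cells and copies of cubes -/

theorem mem_verts_toSubgraph {V W : Type} {G : SimpleGraph V} {H : SimpleGraph W}
    (f : SimpleGraph.Copy G H) {w : W} : w ∈ f.toSubgraph.verts ↔ ∃ v, f v = w := by
  simp [SimpleGraph.Copy.toSubgraph]

theorem toSubgraph_eq_of_iso {V W : Type} {G : SimpleGraph V} {H : SimpleGraph W}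
    (f g : SimpleGraph.Copy G H) (σ : G ≃g G) (h : ∀ v, f v = g (σ v)) :
    f.toSubgraph = g.toSubgraph := by
  have hfg : f.toHom = g.toHom.comp σ.toHom := RelHom.ext h
  have hσ : SimpleGraph.Subgraph.map σ.toHom (⊤ : G.Subgraph) = ⊤ := by
    ext u v
    · simp
    · simp only [SimpleGraph.Subgraph.map_adj, SimpleGraph.Subgraph.top_adj]
      constructor
      · rintro ⟨u, v, huv, rfl, rfl⟩
        exact σ.map_adj_iff.2 huv
      · exact fun huv => ⟨σ.symm u, σ.symm v, σ.symm.map_adj_iff.2 huv, σ.apply_symm_apply u,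
          σ.apply_symm_apply v⟩
  rw [SimpleGraph.Copy.toSubgraph, SimpleGraph.Copy.toSubgraph, hfg, SimpleGraph.Subgraph.map_comp,
    hσ]

/-- The symmetry of the cube given by a permutation of the coordinates and sign changes. -/
noncomputable def cubeIso {k : ℕ} (π : Equiv.Perm (Fin k)) (s : Fin k → ℤˣ) :
    cubeGraph k ≃g cubeGraph k where
  toFun ε a := s (π a) * ε (π a)
  invFun ε a := s a * ε (π.symm a)
  left_inv ε := funext fun a => by simp [← mul_assoc]
  right_inv ε := funext fun a => by simp [← mul_assoc]
  map_rel_iff' := by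
    intro u v
    change hammingDist _ _ = 1 ↔ hammingDist _ _ = 1
    have : ∀ u v : Fin k → ℤˣ, hammingDist (fun a => s (π a) * u (π a))
        (fun a => s (π a) * v (π a)) = hammingDist u v := fun u v =>
      Finset.card_equiv π fun a => by simp
    exact Eq.congr_left (this u v)

theorem cubeAt_toSubgraph_injective (k : ℕ) :
    Function.Injective fun c : Cell n k => (cubeAt c.1 c.2.toEmbedding).toSubgraph := by
  rintro ⟨α, ι⟩ ⟨β, κ⟩ h
  have hv : ∀ γ, (∃ ε, cubeAt α ι.toEmbedding ε = γ) ↔ ∃ ε, cubeAt β κ.toEmbedding ε = γ := by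
    intro γ
    rw [← mem_verts_toSubgraph, ← mem_verts_toSubgraph]
    exact iff_of_eq (congrArg (fun H => γ ∈ SimpleGraph.Subgraph.verts H) h)
  have hbot : ∀ (γ : HoughtonMonoid n) (κ : Fin k ↪o Fin n), cubeAt γ κ.toEmbedding (-1) = γ :=
    fun γ κ => by rw [cubeAt_apply, cubeVec_neg_one, tr_zero]
  -- Each lowest vertex is a translate of the other, so by freeness both translations are trivial.
  obtain rfl : α = β := by
    obtain ⟨ε, hε⟩ := (hv α).1 ⟨_, hbot α ι⟩
    obtain ⟨η, hη⟩ := (hv β).2 ⟨_, hbot β κ⟩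
    rw [cubeAt_apply] at hε hη
    have h0 := hε
    rw [← hη, tr_tr] at h0
    have h1 := tr_eq_self h0
    have h2 : cubeVec κ.toEmbedding ε = 0 := by
      funext i
      have := congrFun h1 i
      simp only [Pi.add_apply, Pi.zero_apply] at this ⊢
      omega
    rw [h2, tr_zero] at hε
    exact hε.symm
  have hsub : ∀ ι κ : Fin k ↪o Fin n, (∀ γ, (∃ ε, cubeAt α ι.toEmbedding ε = γ) →
      ∃ ε, cubeAt α κ.toEmbedding ε = γ) → range ι ⊆ range κ := by
    rintro ι κ h _ ⟨a, rfl⟩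
    obtain ⟨ε, hε⟩ := h _ ⟨1, rfl⟩
    have := congrFun (tr_left_injective α hε) (ι a)
    have e : cubeVec ι.toEmbedding 1 (ι a) = _ := cubeVec_apply ι.toEmbedding 1 a
    rw [e] at this
    by_contra hi
    rw [cubeVec_of_notMem κ.toEmbedding ε hi] at this
    simp at this
  rw [OrderEmbedding.range_inj.1 ((hsub ι κ fun γ => (hv γ).1).antisymm
    (hsub κ ι fun γ => (hv γ).2))]

/-- Sorting the directions of `f` and removing its signs is a symmetry of the cube, which does not
change the subgraph. -/
theorem exists_cubeAt_toSubgraph_eq {k : ℕ} (f : SimpleGraph.Copy (cubeGraph k) (cayleyGraph n)) :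
    ∃ c : Cell n k, (cubeAt c.1 c.2.toEmbedding).toSubgraph = f.toSubgraph := by
  obtain ⟨α, ι, s, h⟩ := exists_eq_cubeAt f
  set S : Finset (Fin n) := Finset.univ.map ι
  have hS : S.card = k := by simp [S]
  set κ := S.orderEmbOfFin hS
  have hκ : range κ = range ι := (S.range_orderEmbOfFin hS).trans (by simp [S])
  have hπ : ∀ a, ∃ b, ι b = κ a := fun a => by
    have : κ a ∈ range κ := mem_range_self a
    rwa [hκ] at this
  choose π hπ using hπ
  have hinj : Function.Injective π := fun a b hab => κ.injective (by rw [← hπ, ← hπ, hab])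
  set π' : Equiv.Perm (Fin k) := Equiv.ofBijective π (Finite.injective_iff_bijective.1 hinj)
  refine ⟨(α, κ), (toSubgraph_eq_of_iso f _ (cubeIso π' s) fun ε => ?_).symm⟩
  rw [h, cubeAt_apply, cubeAt_apply]
  congr 1
  funext i
  by_cases hi : i ∈ range κ
  · obtain ⟨a, rfl⟩ := hi
    refine Eq.trans ?_ (cubeVec_apply κ.toEmbedding _ a).symm
    rw [← hπ a, cubeVec_apply]
    rfl
  · rw [cubeVec_of_notMem κ.toEmbedding _ hi, cubeVec_of_notMem ι _ (hκ ▸ hi)]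

theorem isStandard_cubicalComplex (n : ℕ) : IsStandard (cubicalComplex n) := by
  intro k
  refine ⟨Equiv.ofBijective (fun c : Cell n k => ⟨(cubeAt c.1 c.2.toEmbedding).toSubgraph,
    ⟨(cubeAt c.1 c.2.toEmbedding).isoToSubgraph⟩⟩) ⟨fun c d h => ?_, fun H => ?_⟩, fun c => ?_⟩
  · exact cubeAt_toSubgraph_injective k (congrArg Subtype.val h)
  · obtain ⟨H, hH⟩ := H
    obtain ⟨f, -, rfl⟩ := SimpleGraph.Copy.toSubgraph_surjOn hH
    obtain ⟨c, hc⟩ := exists_cubeAt_toSubgraph_eq f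
    exact ⟨c, Subtype.ext hc⟩
  · exact ⟨cubeAt c.1 c.2.toEmbedding, rfl, fun x => (charMap_cubeAt _ _ x).symm⟩

end HoughtonComplex

/-! ### Simple connectivity -/

/-- A loop is null-homotopic if its image under a map homotopic to the identity is. -/
theorem homotopic_refl_of_map {X : Type} [TopologicalSpace X] {g : C(X, X)}
    (F : (ContinuousMap.id X).Homotopy g) {x : X} (γ : Path x x)
    (h : (γ.map (map_continuous g)).Homotopic (Path.refl (g x))) : γ.Homotopic (Path.refl x) := by
  set e : Path x (g x) := F.evalAt x
  have h1 : (γ.trans e).Homotopic (e.trans (γ.map (map_continuous g))) :=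
    Path.Homotopic.map_trans_evalAt F γ
  rw [← Path.Homotopic.Quotient.eq] at h h1 ⊢
  rw [Path.Homotopic.Quotient.mk_trans, Path.Homotopic.Quotient.mk_trans, h] at h1
  calc Path.Homotopic.Quotient.mk γ
      = ((Path.Homotopic.Quotient.mk γ).trans (Path.Homotopic.Quotient.mk e)).trans
          (Path.Homotopic.Quotient.mk e).symm := by simp
    _ = Path.Homotopic.Quotient.mk (Path.refl x) := by
      rw [h1]
      simp

/-- A loop that factors through a simply connected space is null-homotopic. -/
theorem homotopic_refl_of_factor {X Z : Type} [TopologicalSpace X] [TopologicalSpace Z]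
    [SimplyConnectedSpace Z] (p : C(Z, X)) (q : C(X, Z)) {x : X} (γ : Path x x)
    (h : ∀ t, p (q (γ t)) = γ t) : γ.Homotopic (Path.refl x) := by
  have hx : x = p (q x) := by simpa using (h 0).symm
  have h1 : (γ.map (map_continuous q)).Homotopic (Path.refl (q x)) :=
    SimplyConnectedSpace.paths_homotopic _ _
  have h2 := (h1.map p).pathCast hx hx
  have e1 : ((γ.map (map_continuous q)).map (map_continuous p)).cast hx hx = γ := by
    ext t
    exact h t
  have e2 : ((Path.refl (q x)).map (map_continuous p)).cast hx hx = Path.refl x := by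
    ext t
    exact hx.symm
  rwa [e1, e2] at h2

/-- If each cube of a complex lies in a member of an increasing sequence of sets, then so does each
compact set. -/
theorem CubeFilling.exists_subset_of_isCompact {V : Type} {G : SimpleGraph V}
    [T2Space (CubeFilling G)] {U : ℕ → Set (CubeFilling G)} (hU : Monotone U)
    (h : ∀ f : ParamCube G, ∃ N, ∀ x, charMap f x ∈ U N) {K : Set (CubeFilling G)}
    (hK : IsCompact K) : ∃ N, K ⊆ U N := by
  by_contra! hcon
  choose y hyK hyU using fun N => not_subset.1 (hcon N)
  -- A cube inside `U N` contains `y M` only for `M < N`, so it meets `A` in a finite set. Thus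
  -- `range y` is closed and discrete, hence finite by compactness, and lies in a single `U M`,
  -- against the choice of `y M`.
  have hclosed : ∀ A ⊆ range y, IsClosed A := by
    intro A hA
    rw [← isOpen_compl_iff, isOpen_iff]
    intro f
    obtain ⟨N, hN⟩ := h f
    have hfin : (y '' Iio N).Finite := (finite_Iio N).image y
    have : charMap f ⁻¹' Aᶜ = charMap f ⁻¹' (A ∩ y '' Iio N)ᶜ := by
      ext x
      simp only [mem_preimage, mem_compl_iff, mem_inter_iff, not_iff_not]
      refine ⟨fun hx => ⟨hx, ?_⟩, fun hx => hx.1⟩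
      obtain ⟨M, hM⟩ := hA hx
      refine ⟨M, ?_, hM⟩
      by_contra hMN
      exact hyU M (hM ▸ hU (not_lt.1 hMN) (hN x))
    rw [this]
    exact ((hfin.inter_of_right A).isClosed.isOpen_compl).preimage (continuous_charMap f)
  have hdisc : DiscreteTopology (range y) := by
    rw [discreteTopology_iff_forall_isClosed]
    intro s
    rw [← preimage_image_eq s Subtype.val_injective]
    exact (hclosed (Subtype.val '' s) (by simp)).preimage continuous_subtype_val
  have hfin : (range y).Finite :=
    (hK.of_isClosed_subset (hclosed _ subset_rfl) (range_subset_iff.2 hyK)).finite ⟨hdisc⟩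
  have hmem : ∀ z, ∃ N, z ∈ U N := by
    rintro ⟨f, x⟩
    obtain ⟨N, hN⟩ := h f
    exact ⟨N, hN x⟩
  choose N hN using hmem
  obtain ⟨M, hM⟩ := (hfin.image N).bddAbove
  exact hyU M (hU (hM (mem_image_of_mem N (mem_range_self M))) (hN (y M)))

/-! ### The flow into one orthant and the contraction of loops -/

namespace HoughtonComplex

open HoughtonMonoid CubeFilling

variable {n : ℕ}

/-- The complex is a quotient of a disjoint union of orthants. -/
theorem isQuotientMap_pt : IsQuotientMap
    fun p : (Σ _ : HoughtonMonoid n, Fin n → ℝ) => pt p.1 p.2 := by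
  refine (isQuotientMap_iff _).2 ⟨isCoinducing_iff.2 fun U => ⟨fun hU => ?_, fun hU => ?_⟩,
    fun z => ?_⟩
  · rw [isOpen_iff]
    intro f
    obtain ⟨β, ι, s, -, h⟩ := exists_charMap_eq (f := f)
    have hc : Continuous fun x : SolidCube f.1 => cellVec ι (signVec s * x) :=
      (continuous_cellVec ι).comp (continuous_const.mul continuous_subtype_val)
    have := (isOpen_sigma_iff.1 hU β).preimage hc
    convert this using 1
    ext x
    simp [h]
  · exact hU.preimage (continuous_sigma fun α => continuous_pt α)
  · obtain ⟨α, v, -, h⟩ := exists_pt_eq z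
    exact ⟨⟨α, v⟩, h⟩

/-- The flow that increases all coordinates. -/
noncomputable def flow (s : ℝ) (z : HoughtonComplex n) : HoughtonComplex n :=
  pt (exists_pt_eq z).choose fun i => (exists_pt_eq z).choose_spec.choose i + s

/-- Uniqueness of normal forms identifies the chosen representative; its integer part can be put
back by `pt_add` after adding `s`. -/
theorem flow_pt {s : ℝ} (hs : 0 ≤ s) (α : HoughtonMonoid n) (v : Fin n → ℝ) :
    flow s (pt α v) = pt α fun i => max (v i) 0 + s := by
  obtain ⟨h1, h2⟩ := (exists_pt_eq (pt α v)).choose_spec.choose_spec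
  obtain ⟨e1, e2⟩ := pt_injective h1 (fun i => sub_floor_mem_Ico (v i)) (h2.trans (pt_floor α v))
  refine (congrArg₂ (fun β (w : Fin n → ℝ) => pt β fun i => w i + s) e1 e2).trans ?_
  rw [← pt_add _ _ fun i => add_nonneg (sub_floor_mem_Ico (v i)).1 hs]
  congr 1
  funext i
  ring

theorem flow_zero (z : HoughtonComplex n) : flow 0 z = z := by
  obtain ⟨α, v, -, rfl⟩ := exists_pt_eq z
  simp [flow_pt, pt_max]

theorem flow_flow {s t : ℝ} (hs : 0 ≤ s) (ht : 0 ≤ t) (z : HoughtonComplex n) :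
    flow s (flow t z) = flow (t + s) z := by
  obtain ⟨α, v, -, rfl⟩ := exists_pt_eq z
  rw [flow_pt ht, flow_pt hs, flow_pt (add_nonneg ht hs)]
  congr 1
  funext i
  rw [max_eq_left (add_nonneg (le_max_right _ _) ht), add_assoc]

/-- The product of a quotient map with the locally compact interval is again a quotient map, so
continuity can be checked on orthants, where the flow is a translation. -/
theorem continuous_flow (N : ℕ) :
    Continuous fun p : HoughtonComplex n × unitInterval => flow (N * (p.2 : ℝ)) p.1 := by
  refine isQuotientMap_pt.continuous_lift_prod_left ?_
  have h : (fun p : (Σ _ : HoughtonMonoid n, Fin n → ℝ) × unitInterval =>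
      flow (N * (p.2 : ℝ)) (pt p.1.1 p.1.2)) =
      fun p => pt p.1.1 fun i => max (p.1.2 i) 0 + N * (p.2 : ℝ) :=
    funext fun p => flow_pt (mul_nonneg (Nat.cast_nonneg _) p.2.2.1) _ _
  simp only [h]
  rw [← Homeomorph.comp_continuous_iff' Homeomorph.sigmaProdDistrib.symm]
  refine continuous_sigma fun α => (continuous_pt α).comp ?_
  change Continuous fun p : (Fin n → ℝ) × unitInterval => fun i => max (p.1 i) 0 + N * (p.2 : ℝ)
  fun_prop

/-- The end of the flow. -/
noncomputable def flowMap (n N : ℕ) : C(HoughtonComplex n, HoughtonComplex n) where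
  toFun := flow N
  continuous_toFun := by
    have h : (flow N : HoughtonComplex n → _) =
        (fun p : HoughtonComplex n × unitInterval => flow (N * (p.2 : ℝ)) p.1) ∘
          fun z => (z, 1) := by
      funext z
      simp
    rw [h]
    exact (continuous_flow N).comp (by fun_prop)

/-- The flow, as a homotopy that starts at the identity. -/
noncomputable def flowHomotopy (n N : ℕ) :
    (ContinuousMap.id (HoughtonComplex n)).Homotopy (flowMap n N) where
  toFun p := flow (N * (p.1 : ℝ)) p.2
  continuous_toFun :=
    Continuous.comp (g := fun p : HoughtonComplex n × unitInterval => flow (N * (p.2 : ℝ)) p.1)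
      (f := fun p : unitInterval × HoughtonComplex n => (p.2, p.1)) (continuous_flow N)
      (continuous_snd.prodMk continuous_fst)
  map_zero_left z := by
    have : (N : ℝ) * ((0 : unitInterval) : ℝ) = 0 := by simp
    change flow (N * ((0 : unitInterval) : ℝ)) z = z
    rw [this, flow_zero]
  map_one_left z := by
    have : (N : ℝ) * ((1 : unitInterval) : ℝ) = N := by simp
    change flow (N * ((1 : unitInterval) : ℝ)) z = flow N z
    rw [this]

/-- Flowing for time `N` moves the orthant of `β` into that of its `N`-fold translate along every
ray; for suitable `N` this is also a translate of `α`. -/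
theorem exists_flow_charMap_mem (α : HoughtonMonoid n) (f : ParamCube (cayleyGraph n)) :
    ∃ N : ℕ, ∀ x, flow N (charMap f x) ∈ range (pt α) := by
  obtain ⟨β, ι, s, -, h⟩ := exists_charMap_eq (f := f)
  obtain ⟨N, b, hb⟩ := exists_tr_eq_tr β α
  refine ⟨N, fun x => ?_⟩
  rw [h, flow_pt (Nat.cast_nonneg N), pt_add β (fun _ => N) fun i => le_max_right _ _, hb,
    ← pt_add α b fun i => le_max_right _ _]
  exact mem_range_self _

theorem exists_flow_mem_of_isCompact (α : HoughtonMonoid n) {K : Set (HoughtonComplex n)}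
    (hK : IsCompact K) : ∃ N : ℕ, ∀ z ∈ K, flow N z ∈ range (pt α) := by
  refine exists_subset_of_isCompact (U := fun N : ℕ => {z | flow N z ∈ range (pt α)})
    (fun M N hMN z hz => ?_) (exists_flow_charMap_mem α) hK
  obtain ⟨v, hv⟩ := hz
  obtain ⟨k, rfl⟩ := Nat.exists_eq_add_of_le hMN
  refine ⟨fun i => max (v i) 0 + k, ?_⟩
  rw [← flow_pt (Nat.cast_nonneg k), hv, flow_flow (Nat.cast_nonneg k) (Nat.cast_nonneg M)]
  push_cast
  rfl

theorem pt_height_sub_shift {α : HoughtonMonoid n} {z : HoughtonComplex n}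
    (hz : z ∈ range (pt α)) : pt α (fun i => height z i - α.shift i) = z := by
  obtain ⟨v, rfl⟩ := hz
  rw [← pt_max α v]
  congr 1
  funext i
  simp [height_pt]

instance : PathConnectedSpace (HoughtonComplex n) := by
  have hr : ∀ (α : HoughtonMonoid n) v w, Joined (pt α v) (pt α w) := fun α v w =>
    ((isPathConnected_range (continuous_pt α)).joinedIn _ (mem_range_self v) _
      (mem_range_self w)).joined
  have htr : ∀ (a : Fin n → ℕ) (α : HoughtonMonoid n) v, ∃ w, pt (tr a α) v = pt α w := by
    intro a α v
    rw [← pt_max, ← pt_add α a fun i => le_max_right _ _]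
    exact ⟨_, rfl⟩
  refine ⟨⟨pt 1 0⟩, fun y z => ?_⟩
  obtain ⟨α, v, -, rfl⟩ := exists_pt_eq y
  obtain ⟨β, w, -, rfl⟩ := exists_pt_eq z
  obtain ⟨N, b, h⟩ := exists_tr_eq_tr α β
  obtain ⟨v', hv'⟩ := htr (fun _ => N) α 0
  obtain ⟨w', hw'⟩ := htr b β 0
  have h1 := hr α v v'
  rw [← hv', h, hw'] at h1
  exact h1.trans (hr β _ _)

/-- The flow pushes a loop into the orthant of `1`, where `height` and `pt 1` factor it through
`ℝⁿ`. -/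
instance : SimplyConnectedSpace (HoughtonComplex n) := by
  refine simply_connected_iff_loops_nullhomotopic.2 ⟨inferInstance, fun x γ => ?_⟩
  obtain ⟨N, hN⟩ := exists_flow_mem_of_isCompact 1 (isCompact_range γ.continuous)
  refine homotopic_refl_of_map (flowHomotopy n N) γ ?_
  have hq : Continuous fun (z : HoughtonComplex n) i =>
      height z i - (HoughtonMonoid.shift (1 : HoughtonMonoid n) i : ℝ) :=
    continuous_pi fun i => ((continuous_apply i).comp continuous_height).sub continuous_const
  exact homotopic_refl_of_factor ⟨pt 1, continuous_pt 1⟩ ⟨_, hq⟩ _ fun t =>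
    pt_height_sub_shift (hN _ (mem_range_self t))

end HoughtonComplex

/-! ### Links of vertices -/

namespace HoughtonMonoid

variable {n : ℕ}

/-- The indicator vector of a set of directions. -/
def ind (T : Finset (Fin n)) : Fin n → ℕ := fun i => if i ∈ T then 1 else 0

theorem ind_of_mem {T : Finset (Fin n)} {i : Fin n} (h : i ∈ T) : ind T i = 1 := if_pos h

theorem ind_of_notMem {T : Finset (Fin n)} {i : Fin n} (h : i ∉ T) : ind T i = 0 := if_neg h

theorem ind_injective : Function.Injective (ind : Finset (Fin n) → Fin n → ℕ) := by
  intro S T h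
  ext i
  have := congrFun h i
  by_cases hS : i ∈ S <;> by_cases hT : i ∈ T <;> simp_all [ind]

theorem tr_ind_injective {α : HoughtonMonoid n} {S T : Finset (Fin n)}
    (h : tr (ind S) α = tr (ind T) α) : S = T :=
  ind_injective (tr_left_injective α h)

theorem ind_singleton_add_erase {T : Finset (Fin n)} {i : Fin n} (hi : i ∈ T) :
    ind {i} + ind (T.erase i) = ind T := by
  funext j
  by_cases hj : j = i
  · subst hj; simp [ind, hi]
  · simp [ind, hj]

/-- Translation along `T` hides only the first values on the rays in `T`; leaving out `i` makes ray
`i` fully visible. -/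
theorem eq_of_tr_erase_eq {β γ : HoughtonMonoid n} {T : Finset (Fin n)}
    (h : tr (ind T) β = tr (ind T) γ)
    (h' : ∀ i ∈ T, tr (ind (T.erase i)) β = tr (ind (T.erase i)) γ) : β = γ := by
  refine ext fun k p => ?_
  by_cases hk : k ∈ T
  · simpa [tr_apply, ind] using congrArg (fun δ => δ.1 (k, p)) (h' k hk)
  · simpa [tr_apply, ind, hk] using congrArg (fun δ => δ.1 (k, p)) h

/-- Prescribed new values are inserted at the beginning of the rays in `T`. -/
theorem exists_tr_ind_eq (α : HoughtonMonoid n) (T : Finset (Fin n)) (x : Fin n → Rays n)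
    (hx : ∀ i ∈ T, x i ∉ range α.1) (hinj : InjOn x T) :
    ∃ β : HoughtonMonoid n, tr (ind T) β = α ∧ ∀ i ∈ T, β.1 (i, 0) = x i := by
  let f : Rays n → Rays n := fun y =>
    if y.1 ∈ T then (if y.2 = 0 then x y.1 else α.1 (y.1, y.2 - 1)) else α.1 y
  have f0 : ∀ k ∈ T, f (k, 0) = x k := fun k hk => by simp [f, hk]
  have f1 : ∀ k ∈ T, ∀ p, f (k, p + 1) = α.1 (k, p) := fun k hk p => by simp [f, hk]
  have f2 : ∀ k ∉ T, ∀ p, f (k, p) = α.1 (k, p) := fun k hk p => by simp [f, hk]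
  -- A point is either a new initial point or an old point pushed outwards by `ind T`.
  have key : ∀ y, (y.1 ∈ T ∧ y.2 = 0 ∧ f y = x y.1) ∨
      ∃ z : Rays n, y = (z.1, z.2 + ind T z.1) ∧ f y = α.1 z := by
    rintro ⟨k, p⟩
    by_cases hk : k ∈ T
    · rcases p with - | p
      · exact Or.inl ⟨hk, rfl, f0 k hk⟩
      · exact Or.inr ⟨(k, p), by simp [ind, hk], f1 k hk p⟩
    · exact Or.inr ⟨(k, p), by simp [ind, hk], f2 k hk p⟩
  have hf : Function.Injective f := by
    intro y y' h
    rcases key y with ⟨h1, h2, h3⟩ | ⟨z, h1, h2⟩ <;> rcases key y' with ⟨h4, h5, h6⟩ | ⟨z', h4, h5⟩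
    · rw [h3, h6] at h
      exact Prod.ext (hinj h1 h4 h) (h2.trans h5.symm)
    · exact absurd ⟨z', by rw [← h3, h, h5]⟩ (hx _ h1)
    · exact absurd ⟨z, by rw [← h6, ← h, h2]⟩ (hx _ h4)
    · rw [h2, h5] at h
      rw [h1, h4, α.2.1 h]
  obtain ⟨m, N, hN⟩ := α.exists_translation
  refine ⟨⟨f, hf, fun k => m k - ind T k, Finset.univ ×ˢ Finset.range (N + 1),
    fun k p hkp => ?_⟩, ext fun k p => ?_, f0⟩
  · have hp : N + 1 ≤ p := by simpa using hkp
    obtain ⟨q, rfl⟩ := Nat.exists_eq_add_of_le' (le_of_add_le_right hp)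
    by_cases hk : k ∈ T
    · obtain ⟨h1, h2⟩ := hN k q (by omega)
      rw [f1 k hk, h2]
      refine ⟨h1, ?_⟩
      simp only [ind_of_mem hk]
      push_cast
      ring
    · obtain ⟨h1, h2⟩ := hN k (q + 1) (by omega)
      rw [f2 k hk, h2]
      refine ⟨h1, ?_⟩
      simp only [ind_of_notMem hk]
      push_cast
      ring
  · change f (k, p + ind T k) = α.1 (k, p)
    by_cases hk : k ∈ T
    · rw [ind_of_mem hk]
      exact f1 k hk p
    · rw [ind_of_notMem hk]
      exact f2 k hk p

end HoughtonMonoid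

/-! ### Cubes containing a vertex and their edges there -/

namespace HoughtonComplex

open HoughtonMonoid CubeFilling

variable {n : ℕ}

theorem pt_mem_cellMap_image_of_support {k : ℕ} {c : Cell n k} {u : Fin n → ℝ}
    (hu : ∀ i, 0 ≤ u i ∧ u i ≤ 1) (hs : ∀ i, u i ≠ 0 → i ∈ range c.2) :
    pt c.1 u ∈ cellMap c '' closedBall (0 : Fin k → ℝ) 1 := by
  refine ⟨fun a => 2 * u (c.2 a) - 1, mem_closedBall_pi_iff.2 fun a => ?_, ?_⟩
  · constructor <;> linarith [hu (c.2 a)]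
  · rw [cellMap]
    congr 1
    funext i
    by_cases hi : i ∈ range c.2
    · obtain ⟨a, rfl⟩ := hi
      refine (cellVec_apply c.2.toEmbedding _ a).trans ?_
      ring
    · rw [cellVec_of_notMem c.2.toEmbedding _ hi]
      exact (not_imp_comm.1 (hs i) hi).symm

/-- The set `T` consists of the directions in which the point lies on the upper side of the cube;
normalizing absorbs them into the vertex. -/
theorem pt_mem_cellMap_image_iff {k : ℕ} {c : Cell n k} {γ : HoughtonMonoid n} {w : Fin n → ℝ}
    (hw : ∀ i, 0 ≤ w i ∧ w i < 1) :
    pt γ w ∈ cellMap c '' closedBall (0 : Fin k → ℝ) 1 ↔ ∃ T : Finset (Fin n),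
      tr (ind T) c.1 = γ ∧ (∀ i ∈ T, i ∈ range c.2 ∧ w i = 0) ∧ ∀ i, w i ≠ 0 → i ∈ range c.2 := by
  classical
  constructor
  · rintro ⟨x, hx, h⟩
    have hu := cellVec_mem_Icc c.2.toEmbedding (mem_closedBall_pi_iff.1 hx)
    have hu0 : ∀ i ∉ range c.2, cellVec c.2.toEmbedding x i = 0 := fun i hi =>
      cellVec_of_notMem c.2.toEmbedding x hi
    rw [cellMap] at h
    set u := cellVec c.2.toEmbedding x
    rw [pt_floor] at h
    obtain ⟨e1, e2⟩ := pt_injective (fun i => sub_floor_mem_Ico (u i)) hw h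
    have hw' : ∀ i, max (u i) 0 - ⌊u i⌋₊ = w i := fun i => congrFun e2 i
    refine ⟨Finset.univ.filter fun i => u i = 1, ?_, fun i hi => ?_, fun i hi => ?_⟩
    · rw [← e1]
      congr 1
      funext i
      by_cases h : u i = 1
      · simp [ind, h]
      · simp [ind, h, Nat.floor_eq_zero.2 (lt_of_le_of_ne (hu i).2 h)]
    · simp only [Finset.mem_filter, Finset.mem_univ, true_and] at hi
      refine ⟨?_, by simp [← hw', hi]⟩
      by_contra h
      simp [hu0 i h] at hi
    · by_contra h
      exact hi (by simp [← hw', hu0 i h])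
  · rintro ⟨T, rfl, hT, hw'⟩
    rw [← pt_add _ _ fun i => (hw i).1]
    refine pt_mem_cellMap_image_of_support (fun i => ?_) fun i hi => ?_
    · by_cases h : i ∈ T
      · simp [(hT i h).2, ind_of_mem h]
      · simpa [ind_of_notMem h] using ⟨(hw i).1, (hw i).2.le⟩
    · by_cases h : i ∈ T
      · exact (hT i h).1
      · exact hw' i (by simpa [ind_of_notMem h] using hi)

theorem pt_zero_mem_cellMap_image_iff {k : ℕ} {c : Cell n k} {γ : HoughtonMonoid n} :
    pt γ 0 ∈ cellMap c '' closedBall (0 : Fin k → ℝ) 1 ↔ ∃ T : Finset (Fin n),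
      tr (ind T) c.1 = γ ∧ ∀ i ∈ T, i ∈ range c.2 := by
  rw [pt_mem_cellMap_image_iff fun i => by simp]
  simp

theorem range_cell_one (e : Cell n 1) : range e.2 = {e.2 0} := by
  ext i
  simp [eq_comm]

theorem edge_subset_iff {k : ℕ} {c : Cell n k} {e : Cell n 1} :
    cellMap e '' closedBall 0 1 ⊆ cellMap c '' closedBall (0 : Fin k → ℝ) 1 ↔
      e.2 0 ∈ range c.2 ∧ ∃ T : Finset (Fin n), tr (ind T) c.1 = e.1 ∧
        (∀ i ∈ T, i ∈ range c.2) ∧ e.2 0 ∉ T := by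
  have hval : ∀ x : Fin 1 → ℝ, cellVec e.2.toEmbedding x (e.2 0) = (1 + x 0) / 2 := fun x =>
    cellVec_apply e.2.toEmbedding x 0
  have hval' : ∀ (x : Fin 1 → ℝ) i, i ≠ e.2 0 → cellVec e.2.toEmbedding x i = 0 := fun x i hi =>
    cellVec_of_notMem e.2.toEmbedding x fun h : i ∈ range e.2 => by
      rw [range_cell_one] at h
      exact hi h
  constructor
  · intro h
    -- The midpoint of the edge decides: its coordinate `1/2` puts the label among the directions of
    -- `c` and outside `T`.
    have h0 : (0 : Fin 1 → ℝ) ∈ ball (0 : Fin 1 → ℝ) 1 := by simp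
    have h1 := h (mem_image_of_mem _ (ball_subset_closedBall h0))
    rw [cellMap, pt_mem_cellMap_image_iff (cellVec_mem_Ico _ h0)] at h1
    obtain ⟨T, h1, h2, h3⟩ := h1
    refine ⟨h3 _ (by simp [hval]), T, h1, fun i hi => (h2 i hi).1, fun hi => ?_⟩
    simpa [hval] using (h2 _ hi).2
  · rintro ⟨h1, T, h2, h3, h4⟩ _ ⟨x, hx, rfl⟩
    have hx' := cellVec_mem_Icc e.2.toEmbedding (mem_closedBall_pi_iff.1 hx)
    rw [cellMap, ← h2, ← pt_add _ _ fun i => (hx' i).1]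
    refine pt_mem_cellMap_image_of_support (fun i => ?_) fun i hi => ?_
    · by_cases h : i ∈ T
      · have : i ≠ e.2 0 := fun h' => h4 (h' ▸ h)
        simp [hval' x i this, ind_of_mem h]
      · simpa [ind_of_notMem h] using hx' i
    · by_cases h : i ∈ T
      · exact h3 i h
      · by_cases h' : i = e.2 0
        · rwa [h']
        · simp [ind_of_notMem h, hval' x i h'] at hi

/-- The edges at the vertex `α` in a cube containing `α`. -/
theorem edge_subset_iff_of_mem {k : ℕ} {c : Cell n k} {e : Cell n 1} {α : HoughtonMonoid n}
    (he : pt α 0 ∈ cellMap e '' closedBall 0 1) {T : Finset (Fin n)} (hT : tr (ind T) c.1 = α)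
    (hTc : ∀ i ∈ T, i ∈ range c.2) :
    cellMap e '' closedBall 0 1 ⊆ cellMap c '' closedBall (0 : Fin k → ℝ) 1 ↔
      e.2 0 ∈ range c.2 ∧ e.1 = tr (ind (T.erase (e.2 0))) c.1 := by
  rw [edge_subset_iff]
  refine and_congr_right fun hi => ⟨?_, fun h => ⟨_, h.symm, fun i hi =>
    hTc i (Finset.mem_of_mem_erase hi), Finset.notMem_erase _ _⟩⟩
  rintro ⟨S, h1, -, h3⟩
  obtain ⟨R, h4, h5⟩ := pt_zero_mem_cellMap_image_iff.1 he
  rw [← h1, ← hT, tr_tr] at h4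
  -- Freeness gives `ind R + ind S = ind T` with `R` contained in the label of `e`, so `S` and `T`
  -- agree off this label.
  have h6 := tr_left_injective _ h4
  rw [← h1]
  congr 2
  refine Finset.ext fun i => ?_
  have h7 := congrFun h6 i
  by_cases hie : i = e.2 0
  · subst hie
    simp [h3]
  · have : i ∉ R := fun h => hie (by simpa [range_cell_one] using h5 i h)
    rw [Pi.add_apply, ind_of_notMem this, zero_add] at h7
    have h8 : i ∈ S ↔ i ∈ T := by
      by_cases hS : i ∈ S <;> by_cases hT : i ∈ T <;> simp_all [ind]
    simp [hie, h8]

theorem mem_edge_iff {e : Cell n 1} {α : HoughtonMonoid n} :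
    pt α 0 ∈ cellMap e '' closedBall 0 1 ↔ e.1 = α ∨ tr (ind {e.2 0}) e.1 = α := by
  rw [pt_zero_mem_cellMap_image_iff]
  constructor
  · rintro ⟨T, h1, h2⟩
    rw [range_cell_one] at h2
    rcases Finset.subset_singleton_iff.1 (fun i hi => Finset.mem_singleton.2 (h2 i hi)) with h | h
    · rw [h] at h1
      exact Or.inl h1
    · rw [h] at h1
      exact Or.inr h1
  · rintro (h | h)
    · exact ⟨∅, h, by simp⟩
    · exact ⟨{e.2 0}, h, by simp⟩

theorem cell_one_ext {e e' : Cell n 1} (h1 : e.1 = e'.1) (h2 : e.2 0 = e'.2 0) : e = e' := by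
  refine Prod.ext h1 (RelEmbedding.ext fun a => ?_)
  rw [Subsingleton.elim a 0, h2]

/-- The condition for two edges at `α` to span a square: they have different labels, and if they
both end at `α` then they insert different values. -/
def IsLinkAdj (α : HoughtonMonoid n) (e e' : Cell n 1) : Prop :=
  e.2 0 ≠ e'.2 0 ∧ (e.1 ≠ α → e'.1 ≠ α → e.1.1 (e.2 0, 0) ≠ e'.1.1 (e'.2 0, 0))

/-- The lower end of the edge with label `i` takes at `(i, 0)` the same value as the lowest vertex
of the cube, so injectivity of that vertex separates the inserted values. -/
theorem isLinkAdj_of_subset {k : ℕ} {c : Cell n k} {e e' : Cell n 1} {α : HoughtonMonoid n}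
    (hc : pt α 0 ∈ cellMap c '' closedBall (0 : Fin k → ℝ) 1)
    (he : pt α 0 ∈ cellMap e '' closedBall 0 1) (he' : pt α 0 ∈ cellMap e' '' closedBall 0 1)
    (h : cellMap e '' closedBall 0 1 ⊆ cellMap c '' closedBall (0 : Fin k → ℝ) 1)
    (h' : cellMap e' '' closedBall 0 1 ⊆ cellMap c '' closedBall (0 : Fin k → ℝ) 1)
    (hne : e ≠ e') : IsLinkAdj α e e' := by
  obtain ⟨T, hT, hTc⟩ := pt_zero_mem_cellMap_image_iff.1 hc
  rw [edge_subset_iff_of_mem he hT hTc] at h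
  rw [edge_subset_iff_of_mem he' hT hTc] at h'
  have hd : e.2 0 ≠ e'.2 0 := fun hd => hne (cell_one_ext (by rw [h.2, h'.2, hd]) hd)
  refine ⟨hd, fun _ _ heq => hd ?_⟩
  rw [h.2, h'.2, tr_apply, tr_apply, ind_of_notMem (Finset.notMem_erase _ _),
    ind_of_notMem (Finset.notMem_erase _ _)] at heq
  exact congrArg Prod.fst (c.1.2.1 heq)

/-- Pairwise compatible edges at `α` span a cube. -/
theorem exists_cube_of_pairwise {α : HoughtonMonoid n} {S : Set (Cell n 1)}
    (hS : ∀ e ∈ S, pt α 0 ∈ cellMap e '' closedBall 0 1) (hP : S.Pairwise (IsLinkAdj α)) :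
    ∃ (k : ℕ) (c : Cell n k), pt α 0 ∈ cellMap c '' closedBall (0 : Fin k → ℝ) 1 ∧
      ∀ e : Cell n 1, pt α 0 ∈ cellMap e '' closedBall 0 1 →
        (cellMap e '' closedBall 0 1 ⊆ cellMap c '' closedBall (0 : Fin k → ℝ) 1 ↔ e ∈ S) := by
  classical
  have huniq : ∀ e ∈ S, ∀ e' ∈ S, e.2 0 = e'.2 0 → e = e' := by
    intro e he e' he' h
    by_contra hne
    exact (hP he he' hne).1 h
  -- `D` collects all labels and `T` those of the edges that end at `α` from below. Below, `x i` is
  -- the value at the start of ray `i` of the lower end of the edge labelled `i`.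
  set D : Finset (Fin n) := Finset.univ.filter fun i => ∃ e ∈ S, e.2 0 = i
  set T : Finset (Fin n) := Finset.univ.filter fun i => ∃ e ∈ S, e.2 0 = i ∧ e.1 ≠ α
  have hx : ∀ i : Fin n, ∃ y : Rays n, ∀ e ∈ S, e.2 0 = i → y = e.1.1 (i, 0) := by
    intro i
    by_cases h : ∃ e ∈ S, e.2 0 = i
    · obtain ⟨e, he, hi⟩ := h
      exact ⟨e.1.1 (i, 0), fun e' he' hi' => by rw [huniq e he e' he' (hi.trans hi'.symm)]⟩
    · exact ⟨(i, 0), fun e he hi => absurd ⟨e, he, hi⟩ h⟩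
  choose x hx using hx
  have hdown : ∀ e ∈ S, e.1 ≠ α → tr (ind {e.2 0}) e.1 = α := fun e he hne =>
    (mem_edge_iff.1 (hS e he)).resolve_left hne
  have hTdown : ∀ {i}, i ∈ T ↔ ∃ e ∈ S, e.2 0 = i ∧ e.1 ≠ α := by simp [T]
  -- Inserting all values at once gives the lowest vertex. They avoid the image of `α` since each
  -- lower end is injective, and pairwise compatibility makes them distinct.
  obtain ⟨β, hβ, hβx⟩ := exists_tr_ind_eq α T x (by
    rintro i hi ⟨⟨k, p⟩, hy⟩
    obtain ⟨e, he, rfl, hne⟩ := hTdown.1 hi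
    rw [hx _ e he rfl, ← hdown e he hne, tr_apply] at hy
    have := e.1.2.1 hy
    simp only [Prod.mk.injEq] at this
    obtain ⟨rfl, h⟩ := this
    simp [ind] at h) (by
    intro i hi j hj hij
    obtain ⟨e, he, rfl, hne⟩ := hTdown.1 hi
    obtain ⟨e', he', rfl, hne'⟩ := hTdown.1 hj
    rw [hx _ e he rfl, hx _ e' he' rfl] at hij
    by_contra h
    have hee : e ≠ e' := fun h' => h (by rw [h'])
    exact (hP he he' hee).2 hne hne' hij)
  have hrange : range (D.orderEmbOfFin rfl) = D := D.range_orderEmbOfFin rfl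
  have hTD : ∀ i ∈ T, i ∈ range (D.orderEmbOfFin rfl) := by
    intro i hi
    obtain ⟨e, he, h, -⟩ := hTdown.1 hi
    rw [hrange]
    exact Finset.mem_coe.2 (Finset.mem_filter.2 ⟨Finset.mem_univ _, e, he, h⟩)
  refine ⟨D.card, (β, D.orderEmbOfFin rfl), pt_zero_mem_cellMap_image_iff.2 ⟨T, hβ, hTD⟩,
    fun e he => ?_⟩
  have hbase : ∀ e ∈ S, e.1 = tr (ind (T.erase (e.2 0))) β := by
    intro e he
    by_cases hne : e.1 = α
    · have : e.2 0 ∉ T := by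
        intro h
        obtain ⟨e', he', h1, h2⟩ := hTdown.1 h
        rw [huniq e' he' e he h1] at h2
        exact h2 hne
      rw [Finset.erase_eq_of_notMem this, hβ, hne]
    · have hi : e.2 0 ∈ T := hTdown.2 ⟨e, he, rfl, hne⟩
      have h1 := hdown e he hne
      refine ext fun k p => ?_
      rw [tr_apply]
      by_cases hk : k = e.2 0
      · subst hk
        rw [ind_of_notMem (Finset.notMem_erase _ _)]
        rcases p with - | p
        · rw [hβx _ hi, hx _ e he rfl]
        · have h2 := congrArg (fun γ => γ.1 (e.2 0, p)) (h1.trans hβ.symm)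
          simpa [tr_apply, ind, hi] using h2
      · have h2 := congrArg (fun γ => γ.1 (k, p)) (h1.trans hβ.symm)
        simpa [tr_apply, ind, hk] using h2
  rw [edge_subset_iff_of_mem he hβ hTD, hrange]
  constructor
  · rintro ⟨h1, h2⟩
    obtain ⟨e', he', h3⟩ : ∃ e' ∈ S, e'.2 0 = e.2 0 :=
      (Finset.mem_filter.1 (Finset.mem_coe.1 h1)).2
    have : e = e' := cell_one_ext (by rw [h2, hbase e' he', h3]) h3.symm
    rwa [this]
  · exact fun h => 
      ⟨Finset.mem_coe.2 (Finset.mem_filter.2 ⟨Finset.mem_univ _, e, h, rfl⟩), hbase e h⟩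

theorem exists_edge_subset {k : ℕ} {c : Cell n k} {α : HoughtonMonoid n} {T : Finset (Fin n)}
    (hT : tr (ind T) c.1 = α) (hTc : ∀ i ∈ T, i ∈ range c.2) {i : Fin n} (hi : i ∈ range c.2) :
    ∃ e : Cell n 1, e.1 = tr (ind (T.erase i)) c.1 ∧ e.2 0 = i ∧
      pt α 0 ∈ cellMap e '' closedBall 0 1 ∧
      cellMap e '' closedBall 0 1 ⊆ cellMap c '' closedBall (0 : Fin k → ℝ) 1 := by
  let e : Cell n 1 := (tr (ind (T.erase i)) c.1,
    OrderEmbedding.ofStrictMono (fun _ => i) (Subsingleton.strictMono _))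
  have he : pt α 0 ∈ cellMap e '' closedBall 0 1 := by
    rw [mem_edge_iff]
    by_cases h : i ∈ T
    · right
      change tr (ind {i}) (tr (ind (T.erase i)) c.1) = α
      rw [tr_tr, ind_singleton_add_erase h, hT]
    · left
      change tr (ind (T.erase i)) c.1 = α
      rw [Finset.erase_eq_of_notMem h, hT]
  exact ⟨e, rfl, rfl, he, (edge_subset_iff_of_mem he hT hTc).2 ⟨hi, rfl⟩⟩

/-- A cube containing the vertex `α` is determined by its edges at `α`. -/
theorem cell_eq_of_edges {k l : ℕ} {c : Cell n k} {d : Cell n l} {α : HoughtonMonoid n}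
    (hc : pt α 0 ∈ cellMap c '' closedBall (0 : Fin k → ℝ) 1)
    (hd : pt α 0 ∈ cellMap d '' closedBall (0 : Fin l → ℝ) 1)
    (h : ∀ e : Cell n 1, pt α 0 ∈ cellMap e '' closedBall 0 1 →
      (cellMap e '' closedBall 0 1 ⊆ cellMap c '' closedBall (0 : Fin k → ℝ) 1 ↔
        cellMap e '' closedBall 0 1 ⊆ cellMap d '' closedBall (0 : Fin l → ℝ) 1)) :
    (⟨k, c⟩ : Σ k, Cell n k) = ⟨l, d⟩ := by
  obtain ⟨T, hT, hTc⟩ := pt_zero_mem_cellMap_image_iff.1 hc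
  obtain ⟨R, hR, hRd⟩ := pt_zero_mem_cellMap_image_iff.1 hd
  have key : ∀ i ∈ range c.2, i ∈ range d.2 ∧
      tr (ind (T.erase i)) c.1 = tr (ind (R.erase i)) d.1 := by
    intro i hi
    obtain ⟨e, h1, rfl, h3, h4⟩ := exists_edge_subset hT hTc hi
    rw [h e h3, edge_subset_iff_of_mem h3 hR hRd, h1] at h4
    exact h4
  have key' : ∀ i ∈ range d.2, i ∈ range c.2 := by
    intro i hi
    obtain ⟨e, h1, rfl, h3, h4⟩ := exists_edge_subset hR hRd hi
    rw [← h e h3, edge_subset_iff_of_mem h3 hT hTc] at h4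
    exact h4.1
  -- For a direction `i` of `c`, membership in `T` or `R` says whether `α` is the upper end of the
  -- edge with label `i`, and the two cubes share this edge.
  have hTR : T = R := by
    have hTR' : ∀ i ∈ range c.2, (i ∈ T ↔ i ∈ R) := by
      intro i hi
      have h1 := (key i hi).2
      constructor
      · intro hiT
        by_contra hiR
        rw [Finset.erase_eq_of_notMem hiR, hR, ← hT] at h1
        exact Finset.erase_eq_self.1 (tr_ind_injective h1) hiT
      · intro hiR
        by_contra hiT
        rw [Finset.erase_eq_of_notMem hiT, hT, ← hR] at h1
        exact Finset.erase_eq_self.1 (tr_ind_injective h1.symm) hiR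
    ext i
    exact ⟨fun hi => (hTR' i (hTc i hi)).1 hi, fun hi => (hTR' i (key' i (hRd i hi))).2 hi⟩
  subst hTR
  have h1 : c.1 = d.1 := eq_of_tr_erase_eq (hT.trans hR.symm) fun i hi => (key i (hTc i hi)).2
  have hr : range c.2 = range d.2 := Subset.antisymm (fun i hi => (key i hi).1) key'
  obtain rfl : k = l := by
    have := congrArg Set.ncard hr
    rwa [← image_univ, ← image_univ, ncard_image_of_injective _ c.2.injective,
      ncard_image_of_injective _ d.2.injective, ncard_univ, ncard_univ, Nat.card_fin,
      Nat.card_fin] at this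
  rw [Prod.ext h1 (OrderEmbedding.range_inj.1 hr)]

theorem point_eq (v : Cell n 0) : (cubicalComplex n).point v = pt v.1 0 := by
  change pt v.1 (cellVec v.2.toEmbedding 0) = pt v.1 0
  congr 1
  funext i
  exact cellVec_of_notMem _ _ fun ⟨a, _⟩ => a.elim0

theorem point_mem_cube_iff {v : Cell n 0} {k : ℕ} {c : Cell n k} :
    (cubicalComplex n).point v ∈ (cubicalComplex n).cube k c ↔
      pt v.1 0 ∈ cellMap c '' closedBall (0 : Fin k → ℝ) 1 := by
  rw [← point_eq]
  rfl

theorem linkSimplex_pairwise (v : Cell n 0) (c : (cubicalComplex n).Star v) :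
    ((cubicalComplex n).linkSimplex v c).Pairwise fun e e' => IsLinkAdj v.1 e.1 e'.1 :=
  fun e he e' he' hne => isLinkAdj_of_subset (point_mem_cube_iff.1 c.2) (point_mem_cube_iff.1 e.2)
    (point_mem_cube_iff.1 e'.2) he he' fun h => hne (Subtype.ext h)

theorem exists_linkSimplex_eq (v : Cell n 0) {S : Set ((cubicalComplex n).LinkVertex v)}
    (hS : S.Pairwise fun e e' => IsLinkAdj v.1 e.1 e'.1) :
    ∃ c, (cubicalComplex n).linkSimplex v c = S := by
  obtain ⟨k, c, hc, h⟩ := exists_cube_of_pairwise (α := v.1) (S := Subtype.val '' S) (by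
      rintro _ ⟨e, -, rfl⟩
      exact point_mem_cube_iff.1 e.2) (by
      rintro _ ⟨e, he, rfl⟩ _ ⟨e', he', rfl⟩ hne
      exact hS he he' fun h => hne (congrArg Subtype.val h))
  refine ⟨⟨⟨k, c⟩, point_mem_cube_iff.2 hc⟩,
    Set.ext fun e => (h e.1 (point_mem_cube_iff.1 e.2)).trans ?_⟩
  exact Subtype.val_injective.mem_set_image

/-- The faces are the nonempty finite sets of pairwise `IsLinkAdj` edges. Such a family is flag by
its form, and the preceding lemmas identify it with the simplices coming from cubes. -/
theorem hasFlagLink (v : Cell n 0) : (cubicalComplex n).HasFlagLink v := by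
  refine ⟨fun c d hcd => Subtype.ext ?_, ?_⟩
  · exact cell_eq_of_edges (point_mem_cube_iff.1 c.2) (point_mem_cube_iff.1 d.2) fun e he =>
      Set.ext_iff.1 hcd ⟨e, point_mem_cube_iff.2 he⟩
  · refine ⟨⟨⟨{s | s.Nonempty ∧ (s : Set ((cubicalComplex n).LinkVertex v)).Pairwise
      fun e e' => IsLinkAdj v.1 e.1 e'.1}, ?_⟩,
      fun e => ⟨by simp, by simp⟩⟩, fun s => ⟨fun hs => ⟨hs.1, exists_linkSimplex_eq v hs.2⟩, ?_⟩,
      fun S hS hadj => ?_⟩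
    · exact fun s hs => ⟨hs.1, fun t hts ht => ⟨ht, hs.2.mono (by exact_mod_cast hts)⟩⟩
    · rintro ⟨hs, c, hc⟩
      refine ⟨hs, ?_⟩
      rw [← hc]
      exact linkSimplex_pairwise v c
    · have hP : S.Pairwise fun e e' => IsLinkAdj v.1 e.1 e'.1 := by
        intro e he e' he' hne
        obtain ⟨s, hs, hse⟩ := hadj e he e' he' hne
        exact hs.2 (by rw [hse]; simp) (by rw [hse]; simp) hne
      -- Pairwise adjacent edges have different labels, so there are at most `n` of them.
      have hfin : S.Finite := by
        refine Set.Finite.of_injOn (f := fun e => (show Cell n 1 from e.1).2 0)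
          (t := (univ : Set (Fin n))) (fun _ _ => mem_univ _) (fun e he e' he' h => ?_) finite_univ
        by_contra hne
        exact (hP he he' hne).1 h
      refine ⟨hfin.toFinset, ⟨by simpa using hS, ?_⟩, hfin.coe_toFinset⟩
      rw [hfin.coe_toFinset]
      exact hP

end HoughtonComplex

theorem mainTheorem5 (n : ℕ) (hn : 1 ≤ n) :
    ∃ K : CubicalComplex (HoughtonComplex n), CubeFilling.IsStandard K ∧ K.IsCubing :=
  ⟨HoughtonComplex.cubicalComplex n, HoughtonComplex.isStandard_cubicalComplex n,
    inferInstance, HoughtonComplex.hasFlagLink⟩
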